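/- Let $C$ be a $\mathbb Z/2$-graded $C^*$-algebra with grading automorphism $\gamma$, regarded as a right Hilbert module over itself with inner product $\langle x,y\rangle=x^*y$, and let $M(C)$ be its multiplier algebra. An \emph{unbounded self-adjoint multiplier} of $C$ is a densely defined right $C$-linear operator $D$ on $C$ with $D=D^*$ such that $1+D^2$ has dense range; an \emph{essentially self-adjoint multiplier} is a densely defined closable right $C$-linear operator whose closure is an unbounded self-adjoint multiplier; $D$ is \emph{odd} if $\gamma D\gamma=-D$. A \emph{core} of $D$ is a dense right submodule $\mathcal C\subseteq\operatorname{dom}(D)$ such that $D$ and $D|_{\mathcal C}$ have the same closure. For $f\in C_0(\mathbb R)$ or $f\in C_b(\mathbb R)$, $f(D)\in M(C)$ denotes the functional calculus of the closure of $D$, determined by $(x\pm i)^{-1}\mapsto(D\pm i)^{-1}$ on $C_0(\mathbb R)$ and extended strictly continuously to $C_b(\mathbb R)$. For $N>0$ put $\mathrm i_N(x)=x(1+N^{-2}x^2)^{-1/2}$ and $D_N=\mathrm i_N(D)\in M(C)$; for $t>0$ put $D_t=t^{-1}D$ and $D_{t,N}=\mathrm i_N(D_t)$. Let $D$ and $D'$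 be odd, essentially self-adjoint multipliers of $C$ that have \emph{bounded commutator}, that is: $D+D'$ (with domain $\operatorname{dom}D\cap\operatorname{dom}D'$) is an essentially self-adjoint multiplier, and there is a common core $\mathcal C$ of $D$, $D'$ and $D+D'$ such that (i) $D_N$ and $D'_N$ map $\mathcal C$ into itself for every $N>0$, and the resolvents $(D\pm i)^{-1}$ and $(D'\pm i)^{-1}$ map $\mathcal C$ bijectively onto itself; (ii) the graded commutator $[D,D']=DD'+D'D$, defined on $\mathcal C$, extends to a bounded operator on $C$. Then for every $f\in C_0(\mathbb R)$, $$\lim_{N\to\infty}\ \limsup_{t\to\infty}\ \bigl\|f(D_{t,N}+D'_{t,N})-f(D_t+D'_t)\bigr\|=0 .$$ -/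

import Mathlib

open Filter Topology
open scoped ZeroAtInfty MultiplierAlgebra

namespace UnboundedMultiplier

variable {C : Type*} [NonUnitalCStarAlgebra C]

/-- A self-adjoint regular operator on the `C⋆`-algebra `C`, viewed as a right Hilbert module over
itself with the inner product `⟪x, y⟫ = x⋆ y`. -/
structure IsSelfAdjointMultiplier (D : C →ₗ.[ℂ] C) : Prop where
  dense_domain : Dense (D.domain : Set C)
  /-- the domain is a right submodule and `D` is right `C`-linear -/
  mul_mem_graph : ∀ x y c : C, (x, y) ∈ D.graph → (x * c, y * c) ∈ D.graph
  /-- `D = D⋆`: the pairs on the right-hand side are the graph of the adjoint `D⋆` -/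
  mem_graph_iff : ∀ x y : C, (x, y) ∈ D.graph ↔
    ∀ z w : C, (z, w) ∈ D.graph → star w * x = star z * y
  /-- regularity: `1 + D²` has dense range -/
  regular : Dense {a : C | ∃ x y z : C, (x, y) ∈ D.graph ∧ (y, z) ∈ D.graph ∧ a = x + z}

/-- An essentially self-adjoint multiplier: a densely defined right-linear operator that is closable
and whose closure is a self-adjoint regular operator. -/
structure IsEssSelfAdjointMultiplier (D : C →ₗ.[ℂ] C) : Prop where
  dense_domain : Dense (D.domain : Set C)
  mul_mem_graph : ∀ x y c : C, (x, y) ∈ D.graph → (x * c, y * c) ∈ D.graph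
  closable : D.IsClosable
  closure_selfAdjoint : IsSelfAdjointMultiplier D.closure

/-- `D` is odd for the grading automorphism `γ`: its domain is `γ`-invariant and `γ D γ = -D`. -/
def IsOdd (γ : C ≃⋆ₐ[ℂ] C) (D : C →ₗ.[ℂ] C) : Prop :=
  ∀ x y : C, (x, y) ∈ D.graph → (γ x, -γ y) ∈ D.graph

/-- A core of `D`: a dense right submodule `S` of the domain such that `D` and its restriction to
`S` have the same closure. -/
structure IsCore (D : C →ₗ.[ℂ] C) (S : Submodule ℂ C) : Prop where
  dense : Dense (S : Set C)
  mul_mem : ∀ x ∈ S, ∀ c : C, x * c ∈ S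
  le_domain : S ≤ D.domain
  closure_eq : (D.domRestrict S).closure = D.closure

/-! ### Resolvents -/

/-- An adjointable operator `S` on the Hilbert module `C`, with adjoint `T`, as a multiplier. -/
noncomputable def ofAdjointPair (S T : C →L[ℂ] C)
    (h : ∀ x y : C, star (S x) * y = star x * T y) : 𝓜(ℂ, C) where
  fst := S
  snd :=
    { toFun := fun a => star (T (star a))
      map_add' := fun a b => by simp
      map_smul' := fun c a => by simp
      cont := by fun_prop }
  central := by
    intro x y
    have := congrArg star (h y (star x))
    simpa using this.symm

/-- The resolvent `(D + s)⁻¹` of (the closure of) `D` as a multiplier of `C`; it is `0` if there is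
no such multiplier. -/
noncomputable def resolvent (D : C →ₗ.[ℂ] C) (s : ℂ) : 𝓜(ℂ, C) :=
  open scoped Classical in
  if h : ∃ R : 𝓜(ℂ, C), ∀ c : C, (R.fst c, c - s • R.fst c) ∈ D.closure.graph then h.choose else 0

namespace IsSelfAdjointMultiplier

variable {D : C →ₗ.[ℂ] C}

lemma isClosed_graph (hD : IsSelfAdjointMultiplier D) : IsClosed (D.graph : Set (C × C)) := by
  have : (D.graph : Set (C × C)) =
      ⋂ p : D.graph, {q : C × C | star p.1.2 * q.1 = star p.1.1 * q.2} := by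
    ext ⟨x, y⟩
    simp only [SetLike.mem_coe, hD.mem_graph_iff x y, Set.mem_iInter, Set.mem_ofPred_eq]
    exact ⟨fun h p => h _ _ p.2, fun h z w hz => h ⟨(z, w), hz⟩⟩
  rw [this]
  exact isClosed_iInter fun p => isClosed_eq (by fun_prop) (by fun_prop)

lemma norm_le (hD : IsSelfAdjointMultiplier D) {s : ℂ} (hs : star s = -s) (hs' : s * s = -1)
    {x y : C} (h : (x, y) ∈ D.graph) : ‖x‖ ≤ ‖y + s • x‖ := by
  let _ := CStarAlgebra.spectralOrder C
  have := CStarAlgebra.spectralOrderedRing C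
  have hsym : star y * x = star x * y := (hD.mem_graph_iff x y).1 h x y h
  have key : star (y + s • x) * (y + s • x) = star x * x + star y * y := by
    have h1 : star s * s = 1 := by rw [hs, neg_mul, hs', neg_neg]
    simp only [star_add, star_smul, add_mul, mul_add, smul_mul_assoc, mul_smul_comm, smul_add,
      hsym]
    rw [smul_smul, mul_comm, h1, hs, one_smul, neg_smul]
    abel
  have hle : star x * x ≤ star (y + s • x) * (y + s • x) := by
    rw [key]
    exact le_add_of_nonneg_right (star_mul_self_nonneg y)
  have := CStarAlgebra.norm_le_norm_of_nonneg_of_le (star_mul_self_nonneg x) hle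
  rw [CStarRing.norm_star_mul_self, CStarRing.norm_star_mul_self] at this
  nlinarith [norm_nonneg x, norm_nonneg (y + s • x)]

lemma exists_unique_solution (hD : IsSelfAdjointMultiplier D) {s : ℂ} (hs : star s = -s)
    (hs' : s * s = -1) (c : C) : ∃! x : C, (x, c - s • x) ∈ D.graph := by
  let L : D.graph →ₗ[ℂ] C :=
    (LinearMap.snd ℂ C C + s • LinearMap.fst ℂ C C).comp D.graph.subtype
  have hL : ∀ p : D.graph, L p = p.1.2 + s • p.1.1 := fun p => rfl
  have hs1 : ‖s‖ = 1 := by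
    have := congrArg norm hs'
    rw [norm_mul, norm_neg, norm_one] at this
    nlinarith [norm_nonneg s]
  have hbd : ∀ p : D.graph, ‖p‖ ≤ (2 : NNReal) * ‖L p‖ := by
    rintro ⟨⟨x, y⟩, hp⟩
    have h1 : ‖x‖ ≤ ‖y + s • x‖ := hD.norm_le hs hs' hp
    have h2 : ‖y‖ ≤ ‖y + s • x‖ + ‖x‖ := by
      calc ‖y‖ = ‖(y + s • x) - s • x‖ := by rw [add_sub_cancel_right]
        _ ≤ ‖y + s • x‖ + ‖s • x‖ := norm_sub_le _ _
        _ = ‖y + s • x‖ + ‖x‖ := by rw [norm_smul, hs1, one_mul]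
    change max ‖x‖ ‖y‖ ≤ 2 * ‖y + s • x‖
    refine max_le ?_ ?_ <;> linarith [norm_nonneg x]
  have hanti : AntilipschitzWith 2 L := AddMonoidHomClass.antilipschitz_of_bound L hbd
  have hbd' : ∀ p : D.graph, ‖L p‖ ≤ 2 * ‖p‖ := by
    rintro ⟨⟨x, y⟩, hp⟩
    change ‖y + s • x‖ ≤ 2 * max ‖x‖ ‖y‖
    calc ‖y + s • x‖ ≤ ‖y‖ + ‖s • x‖ := norm_add_le _ _
      _ = ‖y‖ + ‖x‖ := by rw [norm_smul, hs1, one_mul]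
      _ ≤ 2 * max ‖x‖ ‖y‖ := by linarith [le_max_left ‖x‖ ‖y‖, le_max_right ‖x‖ ‖y‖]
  have huc : UniformContinuous L := (L.mkContinuous 2 hbd').uniformContinuous
  have : CompleteSpace D.graph := hD.isClosed_graph.completeSpace_coe
  have hclosed : IsClosed (Set.range L) := hanti.isClosed_range huc
  have hdense : Dense (Set.range L) := by
    refine hD.regular.mono ?_
    rintro a ⟨x, y, z, hxy, hyz, rfl⟩
    refine ⟨⟨(y, z) - s • (x, y), D.graph.sub_mem hyz (D.graph.smul_mem s hxy)⟩, ?_⟩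
    rw [hL]
    change z - s • y + s • (y - s • x) = x + z
    rw [smul_sub, smul_smul, hs', neg_one_smul]
    abel
  have hsurj : ∃ p, L p = c := by
    have := hdense.closure_eq
    rw [hclosed.closure_eq] at this
    exact (this ▸ Set.mem_univ c : c ∈ Set.range L)
  obtain ⟨⟨⟨x, y⟩, hp⟩, hpc⟩ := hsurj
  have hpc' : y + s • x = c := hpc
  refine ⟨x, ?_, ?_⟩
  · change (x, c - s • x) ∈ D.graph
    rwa [← hpc', add_sub_cancel_right]
  · intro x' hx'
    have hL' : L ⟨(x', c - s • x'), hx'⟩ = L ⟨(x, y), hp⟩ := by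
      rw [hpc, hL]
      exact sub_add_cancel _ _
    exact congrArg (fun p : D.graph => p.1.1) (hanti.injective hL')

lemma exists_resolventCLM (hD : IsSelfAdjointMultiplier D) {s : ℂ} (hs : star s = -s)
    (hs' : s * s = -1) : ∃ R : C →L[ℂ] C, ∀ c, (R c, c - s • R c) ∈ D.graph := by
  choose r hr hr' using fun c => hD.exists_unique_solution hs hs' c
  let R : C →ₗ[ℂ] C :=
    { toFun := r
      map_add' := fun a b => by
        refine (hr' (a + b) (r a + r b) ?_).symm
        have := D.graph.add_mem (hr a) (hr b)
        convert this using 1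
        ext
        · rfl
        · change a + b - s • (r a + r b) = (a - s • r a) + (b - s • r b)
          rw [smul_add]; abel
      map_smul' := fun k a => by
        refine (hr' (k • a) (k • r a) ?_).symm
        have := D.graph.smul_mem k (hr a)
        convert this using 1
        ext
        · rfl
        · change k • a - s • k • r a = k • (a - s • r a)
          rw [smul_sub, smul_comm] }
  refine ⟨R.mkContinuous 1 fun c => ?_, hr⟩
  rw [one_mul]
  have := hD.norm_le hs hs' (hr c)
  rwa [sub_add_cancel] at this

lemma resolvent_adjoint (hD : IsSelfAdjointMultiplier D) {s : ℂ} (hs : star s = -s) {a b x y : C}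
    (ha : (a, x - s • a) ∈ D.graph) (hb : (b, y - (-s) • b) ∈ D.graph) :
    star a * y = star x * b := by
  have h1 := (hD.mem_graph_iff _ _).1 hb _ _ ha
  simp only [star_sub, star_smul, hs, neg_smul, sub_neg_eq_add, add_mul, mul_add, smul_mul_assoc,
    mul_smul_comm] at h1
  exact (add_right_cancel h1).symm

lemma exists_resolvent (hD : IsSelfAdjointMultiplier D) {s : ℂ} (hs : star s = -s)
    (hs' : s * s = -1) :
    ∃ R : 𝓜(ℂ, C), ∀ c : C, (R.fst c, c - s • R.fst c) ∈ D.graph := by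
  obtain ⟨R, hR⟩ := hD.exists_resolventCLM hs hs'
  obtain ⟨T, hT⟩ := hD.exists_resolventCLM (s := -s) (by rw [star_neg, hs]) (by rw [neg_mul_neg, hs'])
  exact ⟨ofAdjointPair R T fun x y => hD.resolvent_adjoint hs (hR x) (hT y), hR⟩

end IsSelfAdjointMultiplier

namespace IsEssSelfAdjointMultiplier

variable {D : C →ₗ.[ℂ] C}

lemma resolvent_mem (hD : IsEssSelfAdjointMultiplier D) {s : ℂ} (hs : star s = -s)
    (hs' : s * s = -1) (c : C) :
    ((resolvent D s).fst c, c - s • (resolvent D s).fst c) ∈ D.closure.graph := by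
  have h := hD.closure_selfAdjoint.exists_resolvent hs hs'
  rw [resolvent, dif_pos h]
  exact h.choose_spec c

lemma resolvent_unique (hD : IsEssSelfAdjointMultiplier D) {s : ℂ} (hs : star s = -s)
    (hs' : s * s = -1) {x c : C} (h : (x, c - s • x) ∈ D.closure.graph) :
    (resolvent D s).fst c = x :=
  (hD.closure_selfAdjoint.exists_unique_solution hs hs' c).unique (hD.resolvent_mem hs hs' c) h

end IsEssSelfAdjointMultiplier

lemma multiplier_ext {a b : 𝓜(ℂ, C)} (h : ∀ c, a.fst c = b.fst c) : a = b := by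
  rw [← sub_eq_zero, ← norm_eq_zero, ← DoubleCentralizer.norm_fst, norm_eq_zero]
  ext c
  simp [h c]

lemma star_fst_mul (a : 𝓜(ℂ, C)) (x y : C) : star ((star a).fst x) * y = star x * a.fst y := by
  rw [DoubleCentralizer.star_fst, star_star, a.central]

lemma star_fst_mul' (a : 𝓜(ℂ, C)) (x y : C) : star (a.fst x) * y = star x * (star a).fst y := by
  have := star_fst_mul (star a) x y
  rwa [star_star] at this

lemma star_mul_cancel {a b : C} (h : ∀ y, star a * y = star b * y) : a = b := by
  rw [← sub_eq_zero, ← CStarRing.star_mul_self_eq_zero_iff, star_sub, sub_mul, h, sub_self]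

namespace IsEssSelfAdjointMultiplier

variable {D : C →ₗ.[ℂ] C}

lemma star_resolvent (hD : IsEssSelfAdjointMultiplier D) :
    star (resolvent D Complex.I) = resolvent D (-Complex.I) := by
  refine multiplier_ext fun c => star_mul_cancel fun y => ?_
  rw [star_fst_mul]
  refine (hD.closure_selfAdjoint.resolvent_adjoint (s := -Complex.I) (by simp)
    (hD.resolvent_mem (by simp) (by simp) c) ?_).symm
  have := hD.resolvent_mem (s := Complex.I) (by simp) (by simp) y
  rwa [neg_neg]

lemma resolvent_sub (hD : IsEssSelfAdjointMultiplier D) {s : ℂ} (hs : star s = -s)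
    (hs' : s * s = -1) :
    resolvent D s - resolvent D (-s) = -(2 * s) • (resolvent D s * resolvent D (-s)) := by
  rw [sub_eq_iff_eq_add]
  refine multiplier_ext fun c => hD.resolvent_unique hs hs' ?_
  have h1 := hD.resolvent_mem (s := -s) (by rw [star_neg, hs]) (by rw [neg_mul_neg, hs']) c
  have h2 := hD.resolvent_mem hs hs' ((resolvent D (-s)).fst c)
  have h3 := D.closure.graph.add_mem (D.closure.graph.smul_mem (-(2 * s)) h2) h1
  convert h3 using 1
  ext
  · rfl
  · simp only [DoubleCentralizer.add_fst, DoubleCentralizer.smul_fst, DoubleCentralizer.mul_fst,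
      add_apply, smul_apply, Prod.smul_mk, Prod.mk_add_mk]
    change c - s • (-(2 * s) • (resolvent D s).fst ((resolvent D (-s)).fst c) +
      (resolvent D (-s)).fst c) = _
    module

lemma commute_resolvent (hD : IsEssSelfAdjointMultiplier D) :
    Commute (resolvent D Complex.I) (resolvent D (-Complex.I)) := by
  have h1 := hD.resolvent_sub (s := Complex.I) (by simp) (by simp)
  have h2 := hD.resolvent_sub (s := -Complex.I) (by simp) (by simp)
  rw [neg_neg, ← neg_sub, h1, ← neg_smul] at h2
  have h3 : (2 * Complex.I) ≠ 0 := by simp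
  refine smul_right_injective _ h3 ?_
  simpa using h2

end IsEssSelfAdjointMultiplier

/-! ### Functional calculus -/

/-- `f(D)` for `f` continuous and vanishing at infinity: since `w = (x + i)⁻¹` gives
`x = w⁻¹ - i`, this is the continuous functional calculus of the normal multiplier `(D + i)⁻¹`
applied to the function `(x + i)⁻¹ ↦ f x`, `0 ↦ 0`. -/
noncomputable def funCalc (D : C →ₗ.[ℂ] C) (f : ℝ → ℂ) : 𝓜(ℂ, C) :=
  cfc (fun w : ℂ => if w = 0 then 0 else f (w⁻¹ - Complex.I).re) (resolvent D Complex.I)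

/-- `f(D)` for `f` continuous and bounded: the strictly continuous extension of the functional
calculus on `C₀(ℝ)`, i.e. the unique multiplier `T` with `T g(D) = (f g)(D)` for all `g ∈ C₀(ℝ)`. -/
noncomputable def funCalcBdd (D : C →ₗ.[ℂ] C) (f : ℝ → ℂ) : 𝓜(ℂ, C) :=
  open scoped Classical in
  if h : ∃ T : 𝓜(ℂ, C), ∀ g : C₀(ℝ, ℂ), T * funCalc D g = funCalc D (fun x => f x * g x)
  then h.choose else 0

namespace IsEssSelfAdjointMultiplier

variable {D : C →ₗ.[ℂ] C}

lemma isStarNormal_resolvent (hD : IsEssSelfAdjointMultiplier D) :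
    IsStarNormal (resolvent D Complex.I) :=
  ⟨by rw [hD.star_resolvent]; exact hD.commute_resolvent.symm⟩

lemma mem_spectrum (hD : IsEssSelfAdjointMultiplier D) {w : ℂ}
    (hw : w ∈ spectrum ℂ (resolvent D Complex.I)) (hw0 : w ≠ 0) :
    w⁻¹ = ((w⁻¹ - Complex.I).re : ℂ) + Complex.I := by
  have := hD.isStarNormal_resolvent
  set R := resolvent D Complex.I
  have h1 : R - star R = -(2 * Complex.I) • (R * star R) := by
    rw [hD.star_resolvent]; exact hD.resolvent_sub (by simp) (by simp)
  have h2 : cfc (fun w : ℂ => w - star w) R =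
      cfc (fun w : ℂ => -(2 * Complex.I) • (w * star w)) R := by
    rw [cfc_sub (fun w : ℂ => w) (fun w => star w) R, cfc_smul _ (fun w : ℂ => w * star w) R,
      cfc_mul (fun w : ℂ => w) (fun w => star w) R, cfc_id' ℂ R, cfc_star_id R, h1]
  have h3 := (eqOn_of_cfc_eq_cfc h2) hw
  have hw1 : star w ≠ 0 := by simpa using hw0
  have h4 : w⁻¹ - star (w⁻¹) = 2 * Complex.I := by
    rw [star_inv₀]
    field_simp
    simp only [smul_eq_mul] at h3
    linear_combination -h3
  apply Complex.ext
  · simp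
  · have h5 := congrArg Complex.im h4
    simp only [Complex.sub_im, Complex.star_def, Complex.conj_im, Complex.mul_im, Complex.re_ofNat,
      Complex.I_im, Complex.im_ofNat, Complex.I_re] at h5
    simp only [Complex.add_im, Complex.ofReal_im, Complex.I_im]
    linarith

lemma continuousOn_aux (hD : IsEssSelfAdjointMultiplier D) {f : ℝ → ℂ} (hf : Continuous f)
    (hf0 : Tendsto f (cocompact ℝ) (𝓝 0)) :
    ContinuousOn (fun w : ℂ => if w = 0 then 0 else f (w⁻¹ - Complex.I).re)
      (spectrum ℂ (resolvent D Complex.I)) := by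
  intro w hw
  by_cases hw0 : w = 0
  · subst hw0
    rw [← continuousWithinAt_sdiff_self]
    have h1 : Tendsto (fun w : ℂ => ‖w⁻¹ - Complex.I‖)
        (𝓝[spectrum ℂ (resolvent D Complex.I) \ {0}] 0) atTop := by
      refine Tendsto.comp (g := fun z : ℂ => ‖z - Complex.I‖) (y := Bornology.cobounded ℂ) ?_ ?_
      · refine tendsto_atTop_mono (f := fun z : ℂ => ‖z‖ - 1) (fun z => ?_) ?_
        · have := norm_sub_norm_le z Complex.I
          simpa using this
        · exact tendsto_atTop_add_const_right _ _ tendsto_norm_cobounded_atTop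
      · exact (tendsto_inv₀_nhdsNE_zero).mono_left (nhdsWithin_mono _ fun z hz => hz.2)
    have h2 : Tendsto (fun w : ℂ => (w⁻¹ - Complex.I).re)
        (𝓝[spectrum ℂ (resolvent D Complex.I) \ {0}] 0) (cocompact ℝ) := by
      rw [← Metric.cobounded_eq_cocompact, ← tendsto_norm_atTop_iff_cobounded]
      refine h1.congr' ?_
      filter_upwards [self_mem_nhdsWithin] with z hz
      conv_lhs => rw [hD.mem_spectrum hz.1 hz.2, add_sub_cancel_right, Complex.norm_real]
    rw [ContinuousWithinAt, if_pos rfl]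
    refine (hf0.comp h2).congr' ?_
    filter_upwards [self_mem_nhdsWithin] with z hz
    simp [show z ≠ 0 from hz.2]
  · apply ContinuousAt.continuousWithinAt
    have h1 : ContinuousAt (fun w : ℂ => f (w⁻¹ - Complex.I).re) w := by
      refine hf.continuousAt.comp (Complex.continuous_re.continuousAt.comp ?_)
      exact (continuousAt_inv₀ hw0).sub continuousAt_const
    refine h1.congr ?_
    filter_upwards [isOpen_ne.mem_nhds hw0] with z hz
    simp [show z ≠ 0 from hz]

lemma funCalc_mul (hD : IsEssSelfAdjointMultiplier D) {f g : ℝ → ℂ} (hf : Continuous f)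
    (hf0 : Tendsto f (cocompact ℝ) (𝓝 0)) (hg : Continuous g)
    (hg0 : Tendsto g (cocompact ℝ) (𝓝 0)) :
    funCalc D f * funCalc D g = funCalc D (fun x => f x * g x) := by
  rw [funCalc, funCalc, ← cfc_mul _ _ _ (hD.continuousOn_aux hf hf0) (hD.continuousOn_aux hg hg0),
    funCalc]
  congr 1
  ext w
  split_ifs <;> simp

lemma funCalc_add (hD : IsEssSelfAdjointMultiplier D) {f g : ℝ → ℂ} (hf : Continuous f)
    (hf0 : Tendsto f (cocompact ℝ) (𝓝 0)) (hg : Continuous g)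
    (hg0 : Tendsto g (cocompact ℝ) (𝓝 0)) :
    funCalc D f + funCalc D g = funCalc D (fun x => f x + g x) := by
  rw [funCalc, funCalc, ← cfc_add _ _ _ (hD.continuousOn_aux hf hf0) (hD.continuousOn_aux hg hg0),
    funCalc]
  congr 1
  ext w
  split_ifs <;> simp

lemma star_funCalc (f : ℝ → ℂ) :
    star (funCalc D f) = funCalc D (fun x => star (f x)) := by
  rw [funCalc, ← cfc_star, funCalc]
  congr 1
  ext w
  split_ifs <;> simp

lemma funCalc_inv (hD : IsEssSelfAdjointMultiplier D) :
    funCalc D (fun x => ((x : ℂ) + Complex.I)⁻¹) = resolvent D Complex.I := by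
  have := hD.isStarNormal_resolvent
  conv_rhs => rw [← cfc_id' ℂ (resolvent D Complex.I)]
  refine cfc_congr fun w hw => ?_
  by_cases hw0 : w = 0
  · simp [hw0]
  · simp only [hw0, if_false]
    rw [← hD.mem_spectrum hw hw0, inv_inv]

lemma add_I_ne_zero (x : ℝ) : (x : ℂ) + Complex.I ≠ 0 := by
  intro h
  have := congrArg Complex.im h
  simp at this

lemma continuous_inv : Continuous (fun x : ℝ => ((x : ℂ) + Complex.I)⁻¹) :=
  Continuous.inv₀ (by fun_prop) add_I_ne_zero

lemma tendsto_inv : Tendsto (fun x : ℝ => ((x : ℂ) + Complex.I)⁻¹) (cocompact ℝ) (𝓝 0) := by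
  refine tendsto_inv₀_cobounded.comp ?_
  rw [← tendsto_norm_atTop_iff_cobounded, ← Metric.cobounded_eq_cocompact]
  refine tendsto_atTop_mono (f := fun z : ℝ => ‖z‖) (fun z => ?_) tendsto_norm_cobounded_atTop
  have := Complex.abs_re_le_norm ((z : ℂ) + Complex.I)
  simpa using this

lemma tendsto_bdd_mul {f g : ℝ → ℂ} {M : ℝ} (hM : ∀ x, ‖f x‖ ≤ M)
    (hg0 : Tendsto g (cocompact ℝ) (𝓝 0)) :
    Tendsto (fun x => f x * g x) (cocompact ℝ) (𝓝 0) := by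
  refine squeeze_zero_norm (a := fun x => M * ‖g x‖) (fun x => ?_) ?_
  · rw [norm_mul]; exact mul_le_mul_of_nonneg_right (hM x) (norm_nonneg _)
  · simpa using hg0.norm.const_mul M

lemma denseRange_resolvent (hD : IsEssSelfAdjointMultiplier D) :
    DenseRange (resolvent D Complex.I).fst := by
  refine hD.closure_selfAdjoint.dense_domain.mono fun x hx => ?_
  obtain ⟨y, hy⟩ := LinearPMap.mem_domain_iff.1 hx
  refine ⟨y + Complex.I • x, hD.resolvent_unique (by simp) (by simp) ?_⟩
  rwa [add_sub_cancel_right]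

lemma norm_funCalc_mul_inv_le (hD : IsEssSelfAdjointMultiplier D) {f : ℝ → ℂ} (hf : Continuous f)
    {M : ℝ} (hM : ∀ x, ‖f x‖ ≤ M) (y : C) :
    ‖(funCalc D (fun x => f x * ((x : ℂ) + Complex.I)⁻¹)).fst y‖ ≤
      M * ‖(resolvent D Complex.I).fst y‖ := by
  have hM0 : 0 ≤ M := (norm_nonneg _).trans (hM 0)
  set ρ : ℝ → ℂ := fun x => ((x : ℂ) + Complex.I)⁻¹ with hρ
  let k : ℝ → ℂ := fun x => (Real.sqrt (M ^ 2 - ‖f x‖ ^ 2) : ℝ)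
  have hk : Continuous k := by fun_prop
  have hkM : ∀ x, ‖k x‖ ≤ M := fun x => by
    simp only [k, Complex.norm_real, Real.norm_eq_abs, abs_of_nonneg (Real.sqrt_nonneg _)]
    exact Real.sqrt_le_iff.2 ⟨hM0, by nlinarith [sq_nonneg ‖f x‖]⟩
  have hc : ∀ {h : ℝ → ℂ}, Continuous h → Continuous fun x => h x * ρ x :=
    fun hh => hh.mul continuous_inv
  have ht : ∀ {h : ℝ → ℂ}, (∀ x, ‖h x‖ ≤ M) → Tendsto (fun x => h x * ρ x) (cocompact ℝ) (𝓝 0) :=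
    fun hh => tendsto_bdd_mul hh tendsto_inv
  have hs : ∀ {h : ℝ → ℂ}, Continuous h → Tendsto h (cocompact ℝ) (𝓝 0) →
      Continuous (fun x => star (h x)) ∧ Tendsto (fun x => star (h x)) (cocompact ℝ) (𝓝 0) :=
    fun h1 h2 => ⟨h1.star, by simpa using h2.star⟩
  set A := funCalc D (fun x => f x * ρ x)
  set S := funCalc D (fun x => k x * ρ x)
  set R := funCalc D (fun x => (M : ℂ) * ρ x) with hR
  have hcM : Continuous fun _ : ℝ => (M : ℂ) := continuous_const
  have hMM : ∀ _ : ℝ, ‖(M : ℂ)‖ ≤ M := fun _ => by simp [abs_of_nonneg hM0]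
  have hid : star A * A + star S * S = star R * R := by
    have ha := hs (hc hf) (ht hM)
    have hk' := hs (hc hk) (ht hkM)
    have hm := hs (hc hcM) (ht hMM)
    have hmul : ∀ {u v : ℝ → ℂ}, Tendsto u (cocompact ℝ) (𝓝 0) → Tendsto v (cocompact ℝ) (𝓝 0) →
        Tendsto (fun x => u x * v x) (cocompact ℝ) (𝓝 0) := fun hu hv => by
      simpa using hu.mul hv
    have hmulc : ∀ {u v : ℝ → ℂ}, Continuous u → Continuous v → Continuous fun x => u x * v x :=
      fun hu hv => hu.mul hv
    simp only [A, S, R]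
    rw [star_funCalc, star_funCalc, star_funCalc, hD.funCalc_mul ha.1 ha.2 (hc hf) (ht hM),
      hD.funCalc_mul hk'.1 hk'.2 (hc hk) (ht hkM), hD.funCalc_mul hm.1 hm.2 (hc hcM) (ht hMM),
      hD.funCalc_add (hmulc ha.1 (hc hf)) (hmul ha.2 (ht hM)) (hmulc hk'.1 (hc hk))
        (hmul hk'.2 (ht hkM))]
    congr 1
    ext x
    have h1 : ∀ z : ℂ, star z * z = ((‖z‖ ^ 2 : ℝ) : ℂ) := fun z => by
      have := Complex.conj_mul' z
      simpa using this
    simp only [h1]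
    rw [← Complex.ofReal_add]
    congr 1
    simp only [norm_mul, mul_pow, k, Complex.norm_real, Real.norm_eq_abs, sq_abs]
    rw [Real.sq_sqrt (by nlinarith [hM x, norm_nonneg (f x)])]
    ring
  have hRR : R = (M : ℂ) • resolvent D Complex.I := by
    rw [hR, ← hD.funCalc_inv, funCalc, funCalc, ← cfc_smul _ _ _
      (hD.continuousOn_aux continuous_inv tendsto_inv)]
    congr 1
    ext w
    split_ifs <;> simp [ρ]
  let _ := CStarAlgebra.spectralOrder C
  have := CStarAlgebra.spectralOrderedRing C
  have h2 : star (A.fst y) * A.fst y + star (S.fst y) * S.fst y = star (R.fst y) * R.fst y := by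
    rw [star_fst_mul', star_fst_mul', star_fst_mul', ← mul_add]
    have := congrArg (fun a : 𝓜(ℂ, C) => star y * a.fst y) hid
    simpa using this
  have hle : star (A.fst y) * A.fst y ≤ star (R.fst y) * R.fst y := by
    rw [← h2]
    exact le_add_of_nonneg_right (star_mul_self_nonneg _)
  have h3 := CStarAlgebra.norm_le_norm_of_nonneg_of_le (star_mul_self_nonneg _) hle
  rw [CStarRing.norm_star_mul_self, CStarRing.norm_star_mul_self] at h3
  have h4 : ‖A.fst y‖ ≤ ‖R.fst y‖ := by
    nlinarith [norm_nonneg (A.fst y), norm_nonneg (R.fst y)]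
  refine h4.trans_eq ?_
  rw [hRR, DoubleCentralizer.smul_fst, smul_apply, norm_smul]
  simp [abs_of_nonneg hM0]

/-- Existence and uniqueness of `f(D)` for bounded continuous `f`. -/
lemma existsUnique_funCalcBdd (hD : IsEssSelfAdjointMultiplier D) {f : ℝ → ℂ} (hf : Continuous f)
    {M : ℝ} (hM : ∀ x, ‖f x‖ ≤ M) :
    ∃! T : 𝓜(ℂ, C), ∀ g : C₀(ℝ, ℂ), T * funCalc D g = funCalc D (fun x => f x * g x) := by
  set a := resolvent D Complex.I with ha
  have hdense := hD.denseRange_resolvent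
  have hcancel : ∀ {S T : 𝓜(ℂ, C)}, S * a = T * a → S = T := fun {S T} h => by
    refine multiplier_ext fun c => ?_
    refine congrFun (hdense.equalizer S.fst.continuous T.fst.continuous ?_) c
    ext x
    have := congrArg (fun b : 𝓜(ℂ, C) => b.fst x) h
    simpa using this
  let ρ : C₀(ℝ, ℂ) := ⟨⟨fun x => ((x : ℂ) + Complex.I)⁻¹, continuous_inv⟩, tendsto_inv⟩
  have hρ : funCalc D ρ = a := hD.funCalc_inv
  have hρc : Continuous (ρ : ℝ → ℂ) := continuous_inv
  have hρ0 : Tendsto (ρ : ℝ → ℂ) (cocompact ℝ) (𝓝 0) := tendsto_inv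
  have hex : ∀ h : ℝ → ℂ, Continuous h → (∀ x, ‖h x‖ ≤ M) →
      ∃ T : C →L[ℂ] C, ∀ y, T (a.fst y) = (funCalc D (fun x => h x * ρ x)).fst y := by
    intro h hc hb
    exact ⟨(funCalc D (fun x => h x * ρ x)).fst.toLinearMap.extendOfNorm a.fst.toLinearMap,
      LinearMap.extendOfNorm_eq hdense ⟨M, hD.norm_funCalc_mul_inv_le hc hb⟩⟩
  have hfs : Continuous fun x => star (f x) := hf.star
  have hMs : ∀ x, ‖star (f x)‖ ≤ M := by simpa using hM
  have hfρ : Continuous fun x => f x * ρ x := hf.mul hρc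
  have hfρ0 : Tendsto (fun x => f x * ρ x) (cocompact ℝ) (𝓝 0) := tendsto_bdd_mul hM hρ0
  have hfsρ : Continuous fun x => star (f x) * ρ x := hfs.mul hρc
  obtain ⟨T, hT⟩ := hex f hf hM
  obtain ⟨T', hT'⟩ := hex (fun x => star (f x)) hfs hMs
  have hadj : ∀ x y : C, star (T x) * y = star x * T' y := by
    have h1 : ∀ x y : C, star (T (a.fst x)) * a.fst y = star (a.fst x) * T' (a.fst y) := by
      intro x y
      rw [hT, hT', star_fst_mul', star_fst_mul']
      congr 1
      have h2 : star (funCalc D (fun x => f x * ρ x)) * a =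
          star a * funCalc D (fun x => star (f x) * ρ x) := by
        rw [← hρ, star_funCalc, star_funCalc, hD.funCalc_mul (f := fun x => star (f x * ρ x))
          hfρ.star (by simpa using hfρ0.star) hρc hρ0,
          hD.funCalc_mul (f := fun x => star (ρ x)) hρc.star (by simpa using hρ0.star)
          hfsρ (tendsto_bdd_mul hMs hρ0)]
        congr 1
        ext x
        rw [star_mul']
        ring
      have := congrArg (fun b : 𝓜(ℂ, C) => b.fst y) h2
      simpa using this
    intro x y
    have h2 : ∀ x, star (T (a.fst x)) * y = star (a.fst x) * T' y := fun x =>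
      congrFun (DenseRange.equalizer hdense (g := fun y => star (T (a.fst x)) * y)
        (h := fun y => star (a.fst x) * T' y) (by fun_prop) (by fun_prop)
        (funext fun y => h1 x y)) y
    exact congrFun (DenseRange.equalizer hdense (g := fun x => star (T x) * y)
      (h := fun x => star x * T' y) (by fun_prop) (by fun_prop) (funext h2)) x
  have hTa : ofAdjointPair T T' hadj * a = funCalc D (fun x => f x * ρ x) :=
    multiplier_ext fun c => hT c
  refine ⟨ofAdjointPair T T' hadj, fun g => hcancel ?_, fun S hS => hcancel ?_⟩
  · have hg : Continuous (g : ℝ → ℂ) := g.continuous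
    have hg0 : Tendsto (g : ℝ → ℂ) (cocompact ℝ) (𝓝 0) := g.zero_at_infty'
    have hfg : Continuous fun x => f x * g x := hf.mul hg
    have hcomm : funCalc D g * a = a * funCalc D g := by
      rw [← hρ, hD.funCalc_mul hg hg0 hρc hρ0, hD.funCalc_mul hρc hρ0 hg hg0]
      congr 1
      ext x
      exact mul_comm _ _
    rw [mul_assoc, hcomm, ← mul_assoc, hTa, ← hρ, hD.funCalc_mul hfρ hfρ0 hg hg0,
      hD.funCalc_mul hfg (tendsto_bdd_mul hM hg0) hρc hρ0]
    congr 1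
    ext x
    ring
  · rw [hTa, ← hρ]
    exact hS ρ

lemma funCalcBdd_mul (hD : IsEssSelfAdjointMultiplier D) {f : ℝ → ℂ} (hf : Continuous f)
    {M : ℝ} (hM : ∀ x, ‖f x‖ ≤ M) (g : C₀(ℝ, ℂ)) :
    funCalcBdd D f * funCalc D g = funCalc D (fun x => f x * g x) := by
  have h := (hD.existsUnique_funCalcBdd hf hM).exists
  rw [funCalcBdd, dif_pos h]
  exact h.choose_spec g

end IsEssSelfAdjointMultiplier

/-- `f(T)` for a self-adjoint element `T` of the multiplier algebra, by the continuous functional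
calculus (the spectrum of `T` is real, so `f ∘ re` extends `f`). -/
noncomputable def multiplierCalc (T : 𝓜(ℂ, C)) (f : ℝ → ℂ) : 𝓜(ℂ, C) :=
  cfc (fun z : ℂ => f z.re) T

/-- The bounded function `i_N(x) = x (1 + N⁻² x²)^(-1/2)`. -/
noncomputable def iN (N x : ℝ) : ℝ := x * (1 + N⁻¹ ^ 2 * x ^ 2) ^ (-(1 / 2) : ℝ)

/-- The bounded approximant `D_N = i_N(D)`. -/
noncomputable def approximant (D : C →ₗ.[ℂ] C) (N : ℝ) : 𝓜(ℂ, C) :=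
  funCalcBdd D (fun x => (iN N x : ℂ))

/-- The rescaled operator `D_t = t⁻¹ D`. -/
noncomputable def rescale (D : C →ₗ.[ℂ] C) (t : ℝ) : C →ₗ.[ℂ] C := ((t⁻¹ : ℝ) : ℂ) • D

/-- `D` and `D'` (essentially self-adjoint and odd) have bounded commutator. The sum `D + D'` has
domain `dom D ∩ dom D'`, and the graded commutator of the odd operators `D`, `D'` is
`D D' + D' D`. -/
def HasBoundedCommutator (D D' : C →ₗ.[ℂ] C) : Prop :=
  IsEssSelfAdjointMultiplier (D + D') ∧
  ∃ S : Submodule ℂ C,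
    -- a common core
    IsCore D S ∧ IsCore D' S ∧ IsCore (D + D') S ∧
    -- invariance of the core
    (∀ N : ℝ, 0 < N → ∀ c ∈ S, (approximant D N).fst c ∈ S ∧ (approximant D' N).fst c ∈ S) ∧
    (∀ s : ℂ, s = Complex.I ∨ s = -Complex.I →
      Set.BijOn (resolvent D s).fst S S ∧ Set.BijOn (resolvent D' s).fst S S) ∧
    -- the commutator is defined on the core and extends to a bounded operator
    ∃ B : C →L[ℂ] C, ∀ c ∈ S, ∃ x x' y y' : C,
      (c, x) ∈ D.graph ∧ (x, y') ∈ D'.graph ∧ (c, x') ∈ D'.graph ∧ (x', y) ∈ D.graph ∧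
      B c = y + y'

end UnboundedMultiplier

namespace UnboundedMultiplier

variable {C : Type*} [NonUnitalCStarAlgebra C]

open scoped BoundedContinuousFunction

/-! ### The bounded functional calculus as a star homomorphism -/

namespace IsEssSelfAdjointMultiplier

variable {D : C →ₗ.[ℂ] C}

/-! For a self-adjoint `X`, `f(X)` is a continuous function of the normal element `(X + i)⁻¹`, whose
spectrum lies on a fixed circle. By Stone–Weierstrass the calculus is uniformly norm-continuous over
all normal elements with spectrum in that circle (`cfc_uniform`). So it suffices to show that the
resolvents of `D_{t,N} + D'_{t,N}` and `D_t + D'_t` differ by at most `6/N` once `t` is large, with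
a threshold independent of `N`. Rescaling helps because the commutator of `D_t` and `D'_t` is `t⁻²`
times that of `D` and `D'`, hence eventually as small as desired.

Resolvent estimate (`norm_inv_sub_resolvent_le`). Write `a`, `b` for the two approximants and `V =
(a + b + i)⁻¹`. If `‖ab + ba‖ ≤ 1`, then `a² ≤ (a + b)² + 1`, so `‖Va‖ ≤ 1`, and likewise `‖Vb‖ ≤
1`. The error factors as `D - D_N = N⁻¹ D_N τ(D) D` with `|τ| ≤ 1`; `V` absorbs `D_N`, and the small
commutator bounds `‖Dc‖` by a multiple of `‖(D + D' + i)c‖` on the core. This leaves `O(1/N)`.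

Commutator estimate (`norm_approximant_commutator_le`). The delicate point is to bound `ab + ba`
uniformly in `N`. Resolvent identities bound commutators with the rational approximants `l²D/(D² +
l²)`, with no loss. To pass to `i_N(D)`, use the half-angle function `τ`, for which `x(1 - τ²) =
2Nτ`. With `T = τ(D)` and `z = Tb + bT`, this turns a bound on `Db + bD` into a bound on `z - TzT`;
telescoping along `Tⁿ → 0` (strongly) bounds `z` itself (`quadratic_form_le`). Finally `i_N = 2Nτ/(1
+ τ²)` expresses the wanted commutator through `z`. -/

lemma eq_of_mul_resolvent_eq (hD : IsEssSelfAdjointMultiplier D) {S T : 𝓜(ℂ, C)}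
    (h : S * resolvent D Complex.I = T * resolvent D Complex.I) : S = T := by
  refine multiplier_ext fun c => ?_
  refine congrFun (hD.denseRange_resolvent.equalizer S.fst.continuous T.fst.continuous ?_) c
  ext x
  have := congrArg (fun b : 𝓜(ℂ, C) => b.fst x) h
  simpa using this

lemma funCalcBdd_mul_funCalc (hD : IsEssSelfAdjointMultiplier D) (φ : ℝ →ᵇ ℂ) {g : ℝ → ℂ}
    (hg : Continuous g) (hg0 : Tendsto g (cocompact ℝ) (𝓝 0)) :
    funCalcBdd D φ * funCalc D g = funCalc D (fun x => φ x * g x) :=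
  hD.funCalcBdd_mul φ.continuous φ.norm_coe_le_norm ⟨⟨g, hg⟩, hg0⟩

lemma funCalcBdd_mul_resolvent (hD : IsEssSelfAdjointMultiplier D) (φ : ℝ →ᵇ ℂ) :
    funCalcBdd D φ * resolvent D Complex.I =
      funCalc D (fun x => φ x * ((x : ℂ) + Complex.I)⁻¹) := by
  rw [← hD.funCalc_inv, hD.funCalcBdd_mul_funCalc φ continuous_inv tendsto_inv]

lemma continuous_mul_inv (φ : ℝ →ᵇ ℂ) : Continuous fun x : ℝ => φ x * ((x : ℂ) + Complex.I)⁻¹ :=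
  φ.continuous.mul continuous_inv

lemma tendsto_mul_inv (φ : ℝ →ᵇ ℂ) :
    Tendsto (fun x : ℝ => φ x * ((x : ℂ) + Complex.I)⁻¹) (cocompact ℝ) (𝓝 0) :=
  tendsto_bdd_mul φ.norm_coe_le_norm tendsto_inv

lemma funCalc_const_mul (hD : IsEssSelfAdjointMultiplier D) (k : ℂ) {g : ℝ → ℂ}
    (hg : Continuous g) (hg0 : Tendsto g (cocompact ℝ) (𝓝 0)) :
    funCalc D (fun x => k * g x) = k • funCalc D g := by
  rw [funCalc, funCalc, ← cfc_smul _ _ _ (hD.continuousOn_aux hg hg0)]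
  congr 1
  ext w
  split_ifs <;> simp

/-- The bounded continuous functional calculus of an essentially self-adjoint multiplier. -/
noncomputable def bddCalc (hD : IsEssSelfAdjointMultiplier D) : (ℝ →ᵇ ℂ) →⋆ₐ[ℂ] 𝓜(ℂ, C) where
  toFun φ := funCalcBdd D φ
  -- Every algebraic law is tested after right multiplication by the resolvent: its range is dense,
  -- and both sides then lie in the `C₀` calculus.
  map_one' := hD.eq_of_mul_resolvent_eq (by
    rw [hD.funCalcBdd_mul_resolvent, one_mul, ← hD.funCalc_inv]; simp)
  map_zero' := hD.eq_of_mul_resolvent_eq (by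
    rw [hD.funCalcBdd_mul_resolvent, zero_mul]
    have := hD.funCalc_const_mul 0 continuous_inv tendsto_inv
    simpa using this)
  map_mul' φ ψ := hD.eq_of_mul_resolvent_eq (by
    rw [hD.funCalcBdd_mul_resolvent, mul_assoc, hD.funCalcBdd_mul_resolvent,
      hD.funCalcBdd_mul_funCalc _ (continuous_mul_inv ψ) (tendsto_mul_inv ψ)]
    simp [mul_assoc])
  map_add' φ ψ := hD.eq_of_mul_resolvent_eq (by
    rw [hD.funCalcBdd_mul_resolvent, add_mul, hD.funCalcBdd_mul_resolvent,
      hD.funCalcBdd_mul_resolvent, hD.funCalc_add (continuous_mul_inv φ) (tendsto_mul_inv φ)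
      (continuous_mul_inv ψ) (tendsto_mul_inv ψ)]
    simp [add_mul])
  commutes' k := hD.eq_of_mul_resolvent_eq (by
    rw [hD.funCalcBdd_mul_resolvent, ← Algebra.smul_def, ← hD.funCalc_inv,
      ← hD.funCalc_const_mul k continuous_inv tendsto_inv]
    simp [Algebra.algebraMap_eq_smul_one])
  map_star' φ := by
    -- Adjoints move the resolvent to the left, so it is cancelled on both sides, reducing the claim
    -- to `a⋆ φ̄(D) a = (φ(D) a)⋆ a` with `a = (D + i)⁻¹`.
    refine hD.eq_of_mul_resolvent_eq (star_injective (hD.eq_of_mul_resolvent_eq ?_))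
    refine star_injective ?_
    simp only [star_mul, star_star, ← mul_assoc]
    rw [← star_mul, hD.funCalcBdd_mul_resolvent, star_funCalc, mul_assoc,
      hD.funCalcBdd_mul_resolvent, ← hD.funCalc_inv, star_funCalc,
      hD.funCalc_mul ((continuous_mul_inv φ).star) (by simpa using (tendsto_mul_inv φ).star)
        continuous_inv tendsto_inv,
      hD.funCalc_mul continuous_inv.star (by simpa using tendsto_inv.star)
        (continuous_mul_inv _) (tendsto_mul_inv _)]
    congr 1
    ext x
    simp only [star_mul', BoundedContinuousFunction.star_apply]
    ring

lemma bddCalc_apply (hD : IsEssSelfAdjointMultiplier D) (φ : ℝ →ᵇ ℂ) :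
    hD.bddCalc φ = funCalcBdd D φ := rfl

lemma norm_bddCalc_le (hD : IsEssSelfAdjointMultiplier D) (φ : ℝ →ᵇ ℂ) : ‖hD.bddCalc φ‖ ≤ ‖φ‖ :=
  NonUnitalStarAlgHom.norm_apply_le hD.bddCalc φ

lemma bddCalc_mul_apply (hD : IsEssSelfAdjointMultiplier D) (φ ψ : ℝ →ᵇ ℂ) (c : C) :
    (hD.bddCalc (φ * ψ)).fst c = (hD.bddCalc φ).fst ((hD.bddCalc ψ).fst c) := by
  rw [map_mul]; rfl

lemma bddCalc_add_apply (hD : IsEssSelfAdjointMultiplier D) (φ ψ : ℝ →ᵇ ℂ) (c : C) :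
    (hD.bddCalc (φ + ψ)).fst c = (hD.bddCalc φ).fst c + (hD.bddCalc ψ).fst c := by
  rw [map_add]; rfl

lemma bddCalc_sub_apply (hD : IsEssSelfAdjointMultiplier D) (φ ψ : ℝ →ᵇ ℂ) (c : C) :
    (hD.bddCalc (φ - ψ)).fst c = (hD.bddCalc φ).fst c - (hD.bddCalc ψ).fst c := by
  rw [map_sub]; rfl

lemma bddCalc_smul_apply (hD : IsEssSelfAdjointMultiplier D) (k : ℂ) (φ : ℝ →ᵇ ℂ) (c : C) :
    (hD.bddCalc (k • φ)).fst c = k • (hD.bddCalc φ).fst c := by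
  rw [map_smul]; rfl

end IsEssSelfAdjointMultiplier

/-- The bounded continuous function `x ↦ (x + i)⁻¹`. -/
noncomputable def invBCF : ℝ →ᵇ ℂ :=
  .ofNormedAddCommGroup (fun x : ℝ => ((x : ℂ) + Complex.I)⁻¹)
    IsEssSelfAdjointMultiplier.continuous_inv 1 fun x => by
      rw [norm_inv]
      refine inv_le_one_of_one_le₀ ?_
      have := Complex.abs_im_le_norm ((x : ℂ) + Complex.I)
      simpa using this

lemma invBCF_apply (x : ℝ) : invBCF x = ((x : ℂ) + Complex.I)⁻¹ := rfl

lemma norm_multiplier_apply_le (a : 𝓜(ℂ, C)) (c : C) : ‖a.fst c‖ ≤ ‖a‖ * ‖c‖ := by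
  have := a.fst.le_opNorm c
  rwa [DoubleCentralizer.norm_fst] at this

lemma norm_multiplier_le (a : 𝓜(ℂ, C)) {M : ℝ} (hM : 0 ≤ M) (h : ∀ c, ‖a.fst c‖ ≤ M * ‖c‖) :
    ‖a‖ ≤ M := by
  rw [← DoubleCentralizer.norm_fst]
  exact a.fst.opNorm_le_bound hM h

/-! ### Functions of `D`, its domain, and strong limits -/

namespace IsEssSelfAdjointMultiplier

variable {D : C →ₗ.[ℂ] C}

lemma bddCalc_invBCF (hD : IsEssSelfAdjointMultiplier D) :
    hD.bddCalc invBCF = resolvent D Complex.I := by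
  refine hD.eq_of_mul_resolvent_eq ?_
  rw [bddCalc_apply, hD.funCalcBdd_mul_resolvent, ← hD.funCalc_inv,
    hD.funCalc_mul continuous_inv tendsto_inv continuous_inv tendsto_inv]
  rfl

/-- If `φ` and `x φ` are bounded, then `φ(D)` maps into the domain and `D φ(D) = (x φ)(D)`. -/
lemma bddCalc_mem_graph (hD : IsEssSelfAdjointMultiplier D) {φ ψ : ℝ →ᵇ ℂ}
    (h : ∀ x, ψ x = x * φ x) (c : C) :
    ((hD.bddCalc φ).fst c, (hD.bddCalc ψ).fst c) ∈ D.closure.graph := by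
  have h1 : φ = invBCF * (ψ + Complex.I • φ) := by
    ext x
    have := add_I_ne_zero x
    simp only [BoundedContinuousFunction.coe_mul, Pi.mul_apply, invBCF_apply,
      BoundedContinuousFunction.coe_add, Pi.add_apply, BoundedContinuousFunction.coe_smul, h,
      smul_eq_mul]
    field_simp
  have h2 : (hD.bddCalc φ).fst c = (resolvent D Complex.I).fst
      ((hD.bddCalc ψ).fst c + Complex.I • (hD.bddCalc φ).fst c) := by
    conv_lhs => rw [h1]
    rw [hD.bddCalc_mul_apply, hD.bddCalc_add_apply, hD.bddCalc_smul_apply, hD.bddCalc_invBCF]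
  have h3 := hD.resolvent_mem (s := Complex.I) (by simp) (by simp)
    ((hD.bddCalc ψ).fst c + Complex.I • (hD.bddCalc φ).fst c)
  rwa [← h2, add_sub_cancel_right] at h3

/-- If `φ` and `x φ` are bounded, then `(x φ)(D) = φ(D) D` on the domain. -/
lemma bddCalc_apply_of_mem_graph (hD : IsEssSelfAdjointMultiplier D) {φ ψ : ℝ →ᵇ ℂ}
    (h : ∀ x, ψ x = x * φ x) {c d : C} (hc : (c, d) ∈ D.closure.graph) :
    (hD.bddCalc ψ).fst c = (hD.bddCalc φ).fst d := by
  have h1 : ψ * invBCF = φ - Complex.I • (φ * invBCF) := by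
    ext x
    have := add_I_ne_zero x
    simp only [BoundedContinuousFunction.coe_mul, Pi.mul_apply, invBCF_apply,
      BoundedContinuousFunction.coe_sub, Pi.sub_apply, BoundedContinuousFunction.coe_smul, h,
      smul_eq_mul]
    field_simp
    ring
  have h2 : (resolvent D Complex.I).fst (d + Complex.I • c) = c :=
    hD.resolvent_unique (by simp) (by simp) (by rwa [add_sub_cancel_right])
  have h3 := congrArg (fun χ => (hD.bddCalc χ).fst (d + Complex.I • c)) h1
  simp only [hD.bddCalc_mul_apply, hD.bddCalc_sub_apply, hD.bddCalc_smul_apply,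
    hD.bddCalc_invBCF, h2] at h3
  rw [h3, map_add, map_smul, add_sub_cancel_right]

/-- Strong convergence to zero of a bounded sequence of functions of `D`. -/
lemma tendsto_bddCalc_apply (hD : IsEssSelfAdjointMultiplier D) {φ : ℕ → ℝ →ᵇ ℂ} {M : ℝ}
    (hM : ∀ n, ‖φ n‖ ≤ M) (h : Tendsto (fun n => ‖φ n * invBCF‖) atTop (𝓝 0)) (c : C) :
    Tendsto (fun n => (hD.bddCalc (φ n)).fst c) atTop (𝓝 0) := by
  have hM0 : 0 ≤ M := (norm_nonneg _).trans (hM 0)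
  rw [Metric.tendsto_atTop]
  intro ε hε
  -- Uniform boundedness reduces the limit to the dense range of the resolvent; `M + 1` keeps the
  -- denominator nonzero when `M = 0`.
  obtain ⟨d, hd⟩ : ∃ d, dist c ((resolvent D Complex.I).fst d) < ε / (2 * (M + 1)) :=
    hD.denseRange_resolvent.exists_dist_lt c (by positivity)
  have h1 : Tendsto (fun n => ‖φ n * invBCF‖ * ‖d‖) atTop (𝓝 0) := by
    simpa using h.mul_const ‖d‖
  obtain ⟨n₀, hn₀⟩ := Metric.tendsto_atTop.1 h1 (ε / 2) (by positivity)
  refine ⟨n₀, fun n hn => ?_⟩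
  have h2 := hn₀ n hn
  rw [dist_zero_right, Real.norm_of_nonneg (by positivity)] at h2
  rw [dist_zero_right]
  rw [dist_eq_norm] at hd
  have h3 : (hD.bddCalc (φ n)).fst c = (hD.bddCalc (φ n)).fst (c - (resolvent D Complex.I).fst d) +
      (hD.bddCalc (φ n * invBCF)).fst d := by
    rw [hD.bddCalc_mul_apply, hD.bddCalc_invBCF, map_sub, sub_add_cancel]
  have h4 := norm_multiplier_apply_le (hD.bddCalc (φ n)) (c - (resolvent D Complex.I).fst d)
  have h5 := norm_multiplier_apply_le (hD.bddCalc (φ n * invBCF)) d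
  have h6 : ‖hD.bddCalc (φ n)‖ * ‖c - (resolvent D Complex.I).fst d‖ ≤
      (M + 1) * (ε / (2 * (M + 1))) :=
    mul_le_mul ((hD.norm_bddCalc_le _).trans ((hM n).trans (by linarith))) hd.le
      (norm_nonneg _) (by positivity)
  have h7 : (M + 1) * (ε / (2 * (M + 1))) = ε / 2 := by field_simp
  have h8 : ‖hD.bddCalc (φ n * invBCF)‖ * ‖d‖ ≤ ‖φ n * invBCF‖ * ‖d‖ :=
    mul_le_mul_of_nonneg_right (hD.norm_bddCalc_le _) (norm_nonneg _)
  rw [h3]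
  refine (norm_add_le _ _).trans_lt ?_
  linarith

lemma isSelfAdjoint_bddCalc (hD : IsEssSelfAdjointMultiplier D) {φ : ℝ →ᵇ ℂ}
    (h : ∀ x, star (φ x) = φ x) : IsSelfAdjoint (hD.bddCalc φ) := by
  rw [IsSelfAdjoint, ← map_star]
  congr 1
  ext x
  exact h x

end IsEssSelfAdjointMultiplier

/-! ### Explicit bounded functions -/

/-- A bounded continuous real function as a bounded continuous complex-valued function. -/
noncomputable def realBCF (f : ℝ → ℝ) (hf : Continuous f) (M : ℝ) (hM : ∀ x, |f x| ≤ M) :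
    ℝ →ᵇ ℂ :=
  .ofNormedAddCommGroup (fun x => (f x : ℂ)) (Complex.continuous_ofReal.comp hf) M fun x => by
    simpa using hM x

@[simp]
lemma realBCF_apply {f : ℝ → ℝ} {hf : Continuous f} {M : ℝ} {hM : ∀ x, |f x| ≤ M} (x : ℝ) :
    realBCF f hf M hM x = (f x : ℂ) := rfl

lemma norm_realBCF_le {f : ℝ → ℝ} {hf : Continuous f} {M : ℝ} {hM : ∀ x, |f x| ≤ M} :
    ‖realBCF f hf M hM‖ ≤ M :=
  BoundedContinuousFunction.norm_ofNormedAddCommGroup_le _ ((abs_nonneg _).trans (hM 0)) _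

lemma star_realBCF {f : ℝ → ℝ} {hf : Continuous f} {M : ℝ} {hM : ∀ x, |f x| ≤ M} (x : ℝ) :
    star (realBCF f hf M hM x) = realBCF f hf M hM x := by
  simp

lemma one_le_sqrt_one_add_sq (u : ℝ) : 1 ≤ √(1 + u ^ 2) :=
  Real.one_le_sqrt.2 (by nlinarith [sq_nonneg u])

lemma sqrt_one_add_sq_pos (u : ℝ) : 0 < √(1 + u ^ 2) :=
  one_pos.trans_le (one_le_sqrt_one_add_sq u)

lemma sq_sqrt_one_add_sq (u : ℝ) : √(1 + u ^ 2) ^ 2 = 1 + u ^ 2 :=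
  Real.sq_sqrt (by positivity)

lemma abs_le_sqrt_one_add_sq (u : ℝ) : |u| ≤ √(1 + u ^ 2) :=
  Real.abs_le_sqrt (by linarith)

/-- The half-angle function `τ(u) = u / (1 + √(1 + u²))` at `u = x / N`. -/
noncomputable def tauBCF (N : ℝ) : ℝ →ᵇ ℂ :=
  realBCF (fun x => (x / N) / (1 + √(1 + (x / N) ^ 2)))
    (Continuous.div (by fun_prop) (by fun_prop) fun x => by positivity) 1 fun x => by
      have h1 := abs_le_sqrt_one_add_sq (x / N)
      have h2 := sqrt_one_add_sq_pos (x / N)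
      rw [abs_div, abs_of_pos (by positivity : 0 < 1 + √(1 + (x / N) ^ 2)), div_le_one (by positivity)]
      linarith

/-- The function `(1 + u²)^(-1/2)` at `u = x / N`. -/
noncomputable def cosBCF (N : ℝ) : ℝ →ᵇ ℂ :=
  realBCF (fun x => (√(1 + (x / N) ^ 2))⁻¹)
    (Continuous.inv₀ (by fun_prop) fun x => (sqrt_one_add_sq_pos _).ne') 1 fun x => by
      rw [abs_of_pos (inv_pos.2 (sqrt_one_add_sq_pos _))]
      exact inv_le_one_of_one_le₀ (one_le_sqrt_one_add_sq _)

/-- The function `(1 + τ²)⁻¹`. -/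
noncomputable def invOneAddTauSqBCF (N : ℝ) : ℝ →ᵇ ℂ :=
  realBCF (fun x => (1 + √(1 + (x / N) ^ 2)) / (2 * √(1 + (x / N) ^ 2)))
    (Continuous.div (by fun_prop) (by fun_prop)
      fun x => (mul_pos two_pos (sqrt_one_add_sq_pos _)).ne') 1 fun x => by
      have h1 := one_le_sqrt_one_add_sq (x / N)
      rw [abs_of_pos (by positivity), div_le_one (by positivity)]
      linarith

/-- The function `i_N`. -/
noncomputable def iNBCF (N : ℝ) : ℝ →ᵇ ℂ :=
  realBCF (fun x => N * ((x / N) / √(1 + (x / N) ^ 2)))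
    (continuous_const.mul (Continuous.div (by fun_prop) (by fun_prop)
      fun x => (sqrt_one_add_sq_pos _).ne')) |N| fun x => by
      have h1 := abs_le_sqrt_one_add_sq (x / N)
      have h2 := sqrt_one_add_sq_pos (x / N)
      rw [abs_mul, abs_div, abs_of_pos h2]
      exact mul_le_of_le_one_right (abs_nonneg _) ((div_le_one h2).2 h1)

/-- The cut-off function `l² / (x² + l²)` for `l = n + 1`. -/
noncomputable def cutoffBCF (n : ℕ) : ℝ →ᵇ ℂ :=
  realBCF (fun x => ((n : ℝ) + 1) ^ 2 / (x ^ 2 + ((n : ℝ) + 1) ^ 2))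
    (Continuous.div (by fun_prop) (by fun_prop) fun x => by positivity) 1 fun x => by
      rw [abs_of_pos (by positivity), div_le_one (by positivity)]
      nlinarith [sq_nonneg x]

/-- The bounded rational approximant `l² x / (x² + l²)` of `x` for `l = n + 1`. -/
noncomputable def ratBCF (n : ℕ) : ℝ →ᵇ ℂ :=
  realBCF (fun x => x * (((n : ℝ) + 1) ^ 2 / (x ^ 2 + ((n : ℝ) + 1) ^ 2)))
    (continuous_id.mul (Continuous.div (by fun_prop) (by fun_prop) fun x => by positivity))
    ((n : ℝ) + 1) fun x => by
      rw [abs_mul, abs_of_pos (a := _ / _) (by positivity), mul_div_assoc', div_le_iff₀ (by positivity)]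
      have h1 : 0 ≤ (|x| - ((n : ℝ) + 1)) ^ 2 := sq_nonneg _
      have h2 : |x| ^ 2 = x ^ 2 := sq_abs x
      have h3 : (0 : ℝ) < (n : ℝ) + 1 := by positivity
      have h4 : |x| * ((n : ℝ) + 1) ≤ x ^ 2 + ((n : ℝ) + 1) ^ 2 := by nlinarith [abs_nonneg x]
      nlinarith

lemma iN_eq {N : ℝ} (hN : 0 < N) (x : ℝ) : iN N x = N * ((x / N) / √(1 + (x / N) ^ 2)) := by
  have h : N⁻¹ ^ 2 * x ^ 2 = (x / N) ^ 2 := by field_simp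
  rw [iN, h, Real.rpow_neg (by positivity), ← Real.sqrt_eq_rpow, mul_div_assoc',
    mul_div_cancel₀ _ hN.ne']
  exact (div_eq_mul_inv _ _).symm

/-- Double-angle formula for the tangent: with `x / N = tan θ` one has `τ = tan (θ/2)` and `tan θ =
2τ / (1 - τ²)`. -/
lemma mul_one_sub_tau_sq {N : ℝ} (hN : 0 < N) (x : ℝ) :
    x * (1 - ((x / N) / (1 + √(1 + (x / N) ^ 2))) ^ 2) =
      2 * N * ((x / N) / (1 + √(1 + (x / N) ^ 2))) := by
  have h1 := sqrt_one_add_sq_pos (x / N)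
  have h2 := sq_sqrt_one_add_sq (x / N)
  obtain ⟨u, rfl⟩ : ∃ u, x = N * u := ⟨x / N, by field_simp⟩
  rw [mul_div_cancel_left₀ _ hN.ne'] at *
  set s := √(1 + u ^ 2)
  have h3 : 1 + s ≠ 0 := by positivity
  field_simp
  linear_combination u * h2

/-- In the same angle, `i_N = N sin θ` and `sin θ = 2τ / (1 + τ²)`. -/
lemma iN_eq_tau {N : ℝ} (x : ℝ) :
    N * ((x / N) / √(1 + (x / N) ^ 2)) = 2 * N * ((x / N) / (1 + √(1 + (x / N) ^ 2))) *
      ((1 + √(1 + (x / N) ^ 2)) / (2 * √(1 + (x / N) ^ 2))) := by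
  have h1 := sqrt_one_add_sq_pos (x / N)
  generalize x / N = u at *
  set s := √(1 + u ^ 2)
  have h3 : 1 + s ≠ 0 := by positivity
  field_simp

lemma inv_one_add_tau_sq (x : ℝ) {N : ℝ} :
    (1 + √(1 + (x / N) ^ 2)) / (2 * √(1 + (x / N) ^ 2)) *
      (1 + ((x / N) / (1 + √(1 + (x / N) ^ 2))) ^ 2) = 1 := by
  have h1 := sqrt_one_add_sq_pos (x / N)
  have h2 := sq_sqrt_one_add_sq (x / N)
  generalize x / N = u at *
  set s := √(1 + u ^ 2)
  have h3 : 1 + s ≠ 0 := by positivity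
  field_simp
  linear_combination -h2

/-- This is `1 - cos θ = sin θ tan (θ/2)`. It puts a factor `i_N` and a gain `N⁻¹` into the
approximation error. -/
lemma one_sub_cos (x : ℝ) {N : ℝ} (hN : 0 < N) :
    1 - (√(1 + (x / N) ^ 2))⁻¹ = N⁻¹ * (N * ((x / N) / √(1 + (x / N) ^ 2)) *
      ((x / N) / (1 + √(1 + (x / N) ^ 2)))) := by
  have h1 := sqrt_one_add_sq_pos (x / N)
  have h2 := sq_sqrt_one_add_sq (x / N)
  generalize x / N = u at *
  set s := √(1 + u ^ 2)
  have h3 : 1 + s ≠ 0 := by positivity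
  field_simp
  linear_combination h2

lemma norm_ofReal_add_I_sq (x : ℝ) : ‖(x : ℂ) + Complex.I‖ ^ 2 = x ^ 2 + 1 := by
  rw [← Complex.normSq_eq_norm_sq, Complex.normSq_apply]
  simp
  ring

/-- The cut-offs tend to `1` only locally uniformly; the decay of one resolvent factor makes the
convergence uniform. -/
lemma norm_cutoff_sub_one_mul_invBCF_le (n : ℕ) :
    ‖(cutoffBCF n - 1) * invBCF‖ ≤ 1 / ((n : ℝ) + 1) := by
  refine (BoundedContinuousFunction.norm_le (by positivity)).2 fun x => ?_
  have hl : (0 : ℝ) < (n : ℝ) + 1 := by positivity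
  have h1 := norm_ofReal_add_I_sq x
  have h2 : |x| ≤ ‖(x : ℂ) + Complex.I‖ := by
    simpa using Complex.abs_re_le_norm ((x : ℂ) + Complex.I)
  have h3 : 0 < ‖(x : ℂ) + Complex.I‖ := norm_pos_iff.2 (IsEssSelfAdjointMultiplier.add_I_ne_zero x)
  have h4 : (cutoffBCF n - 1) x = ((-(x ^ 2 / (x ^ 2 + ((n : ℝ) + 1) ^ 2)) : ℝ) : ℂ) := by
    simp only [cutoffBCF, BoundedContinuousFunction.coe_sub, Pi.sub_apply, realBCF_apply,
      BoundedContinuousFunction.coe_one, Pi.one_apply]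
    norm_cast
    have : x ^ 2 + ((n : ℝ) + 1) ^ 2 ≠ 0 := by positivity
    push_cast
    field_simp
    ring
  rw [BoundedContinuousFunction.mul_apply, h4, invBCF_apply, norm_mul, norm_inv, Complex.norm_real,
    norm_neg, Real.norm_of_nonneg (by positivity), ← div_eq_mul_inv, div_div, div_le_div_iff₀
    (by positivity) hl, one_mul]
  have h5 : x ^ 2 = |x| * |x| := by rw [abs_mul_abs_self, sq]
  have h6 : |x| * ((n : ℝ) + 1) ≤ x ^ 2 + ((n : ℝ) + 1) ^ 2 := by
    nlinarith [sq_nonneg (|x| - ((n : ℝ) + 1)), abs_nonneg x]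
  calc x ^ 2 * ((n : ℝ) + 1) = |x| * ((n : ℝ) + 1) * |x| := by rw [h5]; ring
    _ ≤ (x ^ 2 + ((n : ℝ) + 1) ^ 2) * ‖(x : ℂ) + Complex.I‖ :=
      mul_le_mul h6 h2 (abs_nonneg _) (by positivity)

/-- Among `p⁰, …, pⁿ` the last is smallest, and their sum times `1 - p` is `1 - pⁿ⁺¹ ≤ 1`. -/
lemma pow_mul_one_sub_le {p : ℝ} (h0 : 0 ≤ p) (h1 : p ≤ 1) (n : ℕ) :
    p ^ n * (1 - p) ≤ 1 / ((n : ℝ) + 1) := by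
  rw [le_div_iff₀ (by positivity)]
  have h2 : ∀ k ∈ Finset.range (n + 1), p ^ n ≤ p ^ k := fun k hk =>
    pow_le_pow_of_le_one h0 h1 (Finset.mem_range_succ_iff.1 hk)
  have h3 := Finset.card_nsmul_le_sum _ _ _ h2
  have h4 := geom_sum_mul_neg p (n + 1)
  rw [Finset.card_range, nsmul_eq_mul] at h3
  push_cast at h3
  have h5 := mul_le_mul_of_nonneg_right h3 (sub_nonneg.2 h1)
  have h6 : 0 ≤ p ^ (n + 1) := by positivity
  linarith

/-- Since `|τ|` has supremum `1`, its powers do not tend to zero in norm. But `1 - |τ|` is at least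
`1 / (2√(1 + (x/N)²))`, a rate of decay that one resolvent factor compensates. -/
lemma norm_tau_pow_mul_invBCF_le {N : ℝ} (hN : 0 < N) (n : ℕ) :
    ‖tauBCF N ^ n * invBCF‖ ≤ 2 * (1 + N⁻¹) / ((n : ℝ) + 1) := by
  refine (BoundedContinuousFunction.norm_le (by positivity)).2 fun x => ?_
  have h1 := norm_ofReal_add_I_sq x
  have h3 : 0 < ‖(x : ℂ) + Complex.I‖ := norm_pos_iff.2 (IsEssSelfAdjointMultiplier.add_I_ne_zero x)
  set u := x / N with hu
  set s := √(1 + u ^ 2) with hs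
  have hs0 : 0 < s := sqrt_one_add_sq_pos u
  have hs2 : s ^ 2 = 1 + u ^ 2 := sq_sqrt_one_add_sq u
  set p := |u| / (1 + s) with hp
  have hp0 : 0 ≤ p := by positivity
  have hus : |u| ≤ s := abs_le_sqrt_one_add_sq u
  have hp1 : p ≤ 1 := (div_le_one (by positivity)).2 (by linarith)
  have hxs : s ≤ (1 + N⁻¹) * ‖(x : ℂ) + Complex.I‖ := by
    refine (sq_le_sq₀ hs0.le (by positivity)).1 ?_
    rw [hs2, mul_pow, h1, hu, div_eq_mul_inv]
    have := inv_pos.2 hN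
    nlinarith [sq_nonneg x, mul_nonneg this.le (sq_nonneg x)]
  have hps : 1 ≤ 2 * s * (1 - p) := by
    have hu2 : |u| ^ 2 = u ^ 2 := sq_abs u
    have h4 : 1 - p = (1 + s - |u|) / (1 + s) := by rw [hp]; field_simp
    rw [h4, mul_div_assoc', le_div_iff₀ (by positivity)]
    nlinarith [one_le_sqrt_one_add_sq u]
  have h5 : ‖tauBCF N x‖ = p := by
    rw [tauBCF, realBCF_apply, Complex.norm_real, norm_div, Real.norm_eq_abs, Real.norm_of_nonneg
      (by positivity)]
  rw [BoundedContinuousFunction.mul_apply, BoundedContinuousFunction.pow_apply, invBCF_apply,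
    norm_mul, norm_inv, norm_pow, h5, ← div_eq_mul_inv, div_le_iff₀ h3]
  have h6 := pow_mul_one_sub_le hp0 hp1 n
  calc p ^ n = p ^ n * 1 := (mul_one _).symm
    _ ≤ p ^ n * (2 * s * (1 - p)) := by gcongr
    _ = 2 * s * (p ^ n * (1 - p)) := by ring
    _ ≤ 2 * ((1 + N⁻¹) * ‖(x : ℂ) + Complex.I‖) * (1 / ((n : ℝ) + 1)) := by
      have : 0 ≤ p ^ n * (1 - p) := mul_nonneg (by positivity) (by linarith)
      gcongr
    _ = 2 * (1 + N⁻¹) / ((n : ℝ) + 1) * ‖(x : ℂ) + Complex.I‖ := by ring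

/-! ### From commutators with rational functions to commutators with `i_N(D)` -/

/-- An operator inequality becomes a `C`-valued form inequality by writing `κ - w = y⋆ y`. -/
lemma star_mul_apply_le [PartialOrder C] [StarOrderedRing C] {w : 𝓜(ℂ, C)}
    (hw : IsSelfAdjoint w) {κ : ℝ} (hκ : ‖w‖ ≤ κ) (v : C) :
    star v * w.fst v ≤ κ • (star v * v) := by
  let _ := CStarAlgebra.spectralOrder 𝓜(ℂ, C)
  have := CStarAlgebra.spectralOrderedRing 𝓜(ℂ, C)
  have h1 : w ≤ algebraMap ℝ 𝓜(ℂ, C) κ :=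
    hw.le_algebraMap_norm_self.trans (algebraMap_mono _ hκ)
  obtain ⟨y, hy⟩ := CStarAlgebra.nonneg_iff_eq_star_mul_self.1 (sub_nonneg.2 h1)
  rw [← sub_nonneg]
  have h2 : κ • (star v * v) - star v * w.fst v = star (y.fst v) * y.fst v := by
    rw [star_fst_mul']
    have h3 := congrArg (fun b : 𝓜(ℂ, C) => star v * b.fst v) hy
    have h4 : (algebraMap ℝ 𝓜(ℂ, C) κ).fst v = κ • v := by
      rw [Algebra.algebraMap_eq_smul_one]; rfl
    simp only [DoubleCentralizer.sub_fst, sub_apply, h4, mul_sub, mul_smul_comm] at h3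
    exact h3
  rw [h2]
  exact star_mul_self_nonneg _

lemma star_apply_mul_apply_le [PartialOrder C] [StarOrderedRing C] {a : 𝓜(ℂ, C)}
    (ha : ‖a‖ ≤ 1) (v : C) : star (a.fst v) * a.fst v ≤ star v * v := by
  have h1 : ‖star a * a‖ ≤ 1 := by
    rw [CStarRing.norm_star_mul_self]
    nlinarith [norm_nonneg a]
  have := star_mul_apply_le (IsSelfAdjoint.star_mul_self a) h1 v
  rw [one_smul] at this
  rw [star_fst_mul']
  exact this

/-- A self-adjoint multiplier is bounded by its quadratic form. -/
lemma norm_le_of_quadratic_form [PartialOrder C] [StarOrderedRing C] {z : 𝓜(ℂ, C)}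
    (hz : IsSelfAdjoint z) {K : ℝ} (hK : 0 ≤ K)
    (h1 : ∀ s, star s * z.fst s ≤ K • (star s * s))
    (h2 : ∀ s, -(star s * z.fst s) ≤ K • (star s * s)) : ‖z‖ ≤ 6 * K := by
  -- Shifting by `K` gives a positive element below `2K s⋆s`; undoing the shift costs one more `K`,
  -- whence `3K`.
  have hq : ∀ s, ‖star s * z.fst s‖ ≤ 3 * K * ‖s‖ ^ 2 := fun s => by
    have h3 : ‖K • (star s * s)‖ = K * ‖s‖ ^ 2 := by
      rw [norm_smul, CStarRing.norm_star_mul_self, Real.norm_of_nonneg hK, sq]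
    have h4 : ‖star s * z.fst s + K • (star s * s)‖ ≤ ‖(2 : ℝ) • K • (star s * s)‖ := by
      refine CStarAlgebra.norm_le_norm_of_nonneg_of_le ?_ ?_
      · have := h2 s
        rwa [neg_le_iff_add_nonneg'] at this
      · rw [two_smul]
        exact add_le_add_left (h1 s) _
    rw [norm_smul, h3, Real.norm_of_nonneg two_pos.le] at h4
    have h5 := norm_sub_le (star s * z.fst s + K • (star s * s)) (K • (star s * s))
    rw [add_sub_cancel_right, h3] at h5
    linarith
  refine norm_multiplier_le _ (by positivity) fun s => ?_
  rcases eq_or_ne (z.fst s) 0 with h0 | h0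
  · rw [h0, norm_zero]; positivity
  have hn : 0 < ‖z.fst s‖ := norm_pos_iff.2 h0
  -- Polarization with `t` parallel to `z s` and of the same norm as `s`: the difference of forms at
  -- `s ± t` has norm `4‖s‖‖z s‖` and is at most `2 · 3K · 4‖s‖²`, which gives `6K`.
  set α : ℝ := ‖s‖ / ‖z.fst s‖ with hα
  set t : C := α • z.fst s with ht
  have htn : ‖t‖ = ‖s‖ := by
    rw [ht, norm_smul, Real.norm_of_nonneg (by positivity), hα]; field_simp
  have hzt : z.fst t = α • z.fst (z.fst s) := (z.fst.restrictScalars ℝ).map_smul α _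
  have h3 : star s * z.fst (z.fst s) = star (z.fst s) * z.fst s := by
    conv_rhs => rw [star_fst_mul', hz.star_eq]
  have h4 : star (s + t) * z.fst (s + t) - star (s - t) * z.fst (s - t) =
      (4 * α) • (star (z.fst s) * z.fst s) := by
    have h5 : star t * z.fst s = α • (star (z.fst s) * z.fst s) := by
      rw [ht, star_smul, smul_mul_assoc]; simp
    have h6 : star s * z.fst t = α • (star (z.fst s) * z.fst s) := by
      rw [hzt, mul_smul_comm, h3]
    have h7 : star (s + t) * z.fst (s + t) - star (s - t) * z.fst (s - t) =
        (2 : ℝ) • (star t * z.fst s) + (2 : ℝ) • (star s * z.fst t) := by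
      simp only [map_add, map_sub, star_add, star_sub, add_mul, mul_add, sub_mul, mul_sub, two_smul]
      abel
    rw [h7, h5, h6, smul_smul, ← add_smul]
    congr 1
    ring
  have h5 := congrArg norm h4
  rw [norm_smul, CStarRing.norm_star_mul_self, Real.norm_of_nonneg (by positivity)] at h5
  have h6 := norm_sub_le (star (s + t) * z.fst (s + t)) (star (s - t) * z.fst (s - t))
  have h7 : ‖s + t‖ ≤ 2 * ‖s‖ := (norm_add_le _ _).trans (by rw [htn]; linarith)
  have h8 : ‖s - t‖ ≤ 2 * ‖s‖ := (norm_sub_le _ _).trans (by rw [htn]; linarith)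
  have h9 : ‖s + t‖ ^ 2 ≤ (2 * ‖s‖) ^ 2 := by gcongr
  have h10 : ‖s - t‖ ^ 2 ≤ (2 * ‖s‖) ^ 2 := by gcongr
  have h11 : 4 * α * (‖z.fst s‖ * ‖z.fst s‖) = 4 * ‖s‖ * ‖z.fst s‖ := by
    rw [hα]; field_simp
  have h12 := hq (s + t)
  have h13 := hq (s - t)
  have h14 := mul_le_mul_of_nonneg_left h9 (by positivity : 0 ≤ 3 * K)
  have h15 := mul_le_mul_of_nonneg_left h10 (by positivity : 0 ≤ 3 * K)
  have h16 : ‖s‖ * ‖z.fst s‖ ≤ ‖s‖ * (6 * K * ‖s‖) := by nlinarith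
  rcases eq_or_ne s 0 with rfl | hs
  · simp
  exact le_of_mul_le_mul_left h16 (norm_pos_iff.2 hs)

namespace IsEssSelfAdjointMultiplier

variable {D : C →ₗ.[ℂ] C}

lemma isSelfAdjoint_ratBCF (hD : IsEssSelfAdjointMultiplier D) (n : ℕ) :
    IsSelfAdjoint (hD.bddCalc (ratBCF n)) :=
  hD.isSelfAdjoint_bddCalc fun x => star_realBCF x

lemma isSelfAdjoint_tauBCF (hD : IsEssSelfAdjointMultiplier D) (N : ℝ) :
    IsSelfAdjoint (hD.bddCalc (tauBCF N)) :=
  hD.isSelfAdjoint_bddCalc fun x => star_realBCF x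

lemma norm_tauBCF_le (hD : IsEssSelfAdjointMultiplier D) (N : ℝ) :
    ‖hD.bddCalc (tauBCF N)‖ ≤ 1 :=
  (hD.norm_bddCalc_le _).trans norm_realBCF_le

lemma approximant_eq (hD : IsEssSelfAdjointMultiplier D) {N : ℝ} (hN : 0 < N) :
    approximant D N = hD.bddCalc (iNBCF N) := by
  rw [approximant, bddCalc_apply]
  congr 1
  ext x
  rw [iN_eq hN]
  rfl

lemma tendsto_cutoff (hD : IsEssSelfAdjointMultiplier D) (c : C) :
    Tendsto (fun n => (hD.bddCalc (cutoffBCF n)).fst c) atTop (𝓝 c) := by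
  have h1 : Tendsto (fun n => (hD.bddCalc (cutoffBCF n - 1)).fst c) atTop (𝓝 0) := by
    refine hD.tendsto_bddCalc_apply (M := 2) (fun n => ?_) ?_ c
    · refine (norm_sub_le _ _).trans ?_
      have h2 : ‖cutoffBCF n‖ ≤ 1 := norm_realBCF_le
      have h3 : ‖(1 : ℝ →ᵇ ℂ)‖ ≤ 1 := by simp
      linarith
    · refine squeeze_zero (fun _ => norm_nonneg _) norm_cutoff_sub_one_mul_invBCF_le ?_
      exact tendsto_one_div_add_atTop_nhds_zero_nat
  have h2 := h1.add_const c
  rw [zero_add] at h2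
  refine h2.congr fun n => ?_
  rw [hD.bddCalc_sub_apply, map_one]
  simp

lemma tendsto_tau_pow (hD : IsEssSelfAdjointMultiplier D) {N : ℝ} (hN : 0 < N) (c : C) :
    Tendsto (fun n => (hD.bddCalc (tauBCF N ^ n)).fst c) atTop (𝓝 0) := by
  refine hD.tendsto_bddCalc_apply (M := 1) (fun n => ?_) ?_ c
  · refine (norm_pow_le _ n).trans (pow_le_one₀ (norm_nonneg _) norm_realBCF_le)
  · refine squeeze_zero (fun _ => norm_nonneg _) (norm_tau_pow_mul_invBCF_le hN) ?_
    have := (tendsto_one_div_add_atTop_nhds_zero_nat (𝕜 := ℝ)).const_mul (2 * (1 + N⁻¹))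
    simpa [div_eq_mul_inv] using this

/-- The relation `D(1 - T²) = 2N T`, multiplied by a cut-off so that every factor is bounded. -/
lemma ratBCF_mul_one_sub_tau_sq {N : ℝ} (hN : 0 < N) (n : ℕ) :
    ratBCF n * (1 - tauBCF N * tauBCF N) = cutoffBCF n * (((2 * N : ℝ) : ℂ) • tauBCF N) := by
  ext x
  have := mul_one_sub_tau_sq hN x
  simp only [BoundedContinuousFunction.coe_mul, Pi.mul_apply, BoundedContinuousFunction.coe_sub,
    Pi.sub_apply, BoundedContinuousFunction.coe_one, Pi.one_apply,
    BoundedContinuousFunction.coe_smul, smul_eq_mul, ratBCF, tauBCF, cutoffBCF, realBCF_apply]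
  have h := congrArg Complex.ofReal this
  push_cast at h ⊢
  linear_combination (((n : ℂ) + 1) ^ 2 / ((x : ℂ) ^ 2 + ((n : ℂ) + 1) ^ 2)) * h

/-- A discrete Lyapunov argument. The defect `p(s) = (κ/2N) s⋆s - s⋆ z s`, with `z = Tb + bT`, does
not increase under `s ↦ T s`: tested on `v = (1 - T²)s`, where `Dv = 2N T s`, the bound on `Db + bD`
controls `s⋆zs - (Ts)⋆z(Ts)`. Since `Tⁿ s → 0`, it follows that `p(s) ≥ p(0) = 0`. -/
lemma quadratic_form_le [PartialOrder C] [StarOrderedRing C] (hD : IsEssSelfAdjointMultiplier D)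
    {b : 𝓜(ℂ, C)} (hb : IsSelfAdjoint b) {κ : ℝ}
    (h : ∀ n, ‖hD.bddCalc (ratBCF n) * b + b * hD.bddCalc (ratBCF n)‖ ≤ κ) {N : ℝ} (hN : 0 < N)
    (s : C) :
    star s * (hD.bddCalc (tauBCF N) * b + b * hD.bddCalc (tauBCF N)).fst s ≤
      (κ / (2 * N)) • (star s * s) := by
  set T := hD.bddCalc (tauBCF N) with hT
  have hTs : star T = T := hD.isSelfAdjoint_tauBCF N
  have hκ : 0 ≤ κ := (norm_nonneg _).trans (h 0)
  let p : C → C := fun s => (κ / (2 * N)) • (star s * s) - star s * (T * b + b * T).fst s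
  have hp : Continuous p := by
    have := (T * b + b * T).fst.continuous
    fun_prop
  have hstep : ∀ s, p (T.fst s) ≤ p s := by
    intro s
    set v : C := (1 - T * T).fst s with hv
    -- Here `Dv = 2N T s` is reached as the limit of the bounded approximants, so the unbounded `D`
    -- never meets `b`.
    have h1 : Tendsto (fun n => (hD.bddCalc (ratBCF n)).fst v) atTop
        (𝓝 ((2 * N) • T.fst s)) := by
      have h2 := hD.tendsto_cutoff ((2 * N) • T.fst s)
      refine h2.congr fun n => ?_
      have h3 := congrArg (fun φ => (hD.bddCalc φ).fst s) (ratBCF_mul_one_sub_tau_sq hN n)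
      have h4 : hD.bddCalc (1 - tauBCF N * tauBCF N) = 1 - T * T := by
        rw [map_sub, map_one, map_mul]
      simp only [hD.bddCalc_mul_apply, hD.bddCalc_smul_apply, h4] at h3
      rw [hv, hT, h3, Complex.coe_smul]
    have h2 : Tendsto (fun n => star v *
        (hD.bddCalc (ratBCF n) * b + b * hD.bddCalc (ratBCF n)).fst v) atTop
        (𝓝 (star ((2 * N) • T.fst s) * b.fst v + star (b.fst v) * ((2 * N) • T.fst s))) := by
      have h3 := ((h1.star).mul_const (b.fst v)).add (h1.const_mul (star (b.fst v)))
      refine h3.congr fun n => ?_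
      rw [star_fst_mul' (hD.bddCalc (ratBCF n)) v, (hD.isSelfAdjoint_ratBCF n).star_eq,
        star_fst_mul' b v, hb.star_eq, ← mul_add]
      rfl
    have h3 : star ((2 * N) • T.fst s) * b.fst v + star (b.fst v) * ((2 * N) • T.fst s) =
        (2 * N) • (star s * (T * b + b * T).fst s -
          star (T.fst s) * (T * b + b * T).fst (T.fst s)) := by
      -- The mixed terms `T b T²` and `T² b T` combine into `T z T`, which makes the expression
      -- telescope.
      have h4 : T * b * (1 - T * T) + (1 - T * T) * b * T =
          (T * b + b * T) - T * (T * b + b * T) * T := by noncomm_ring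
      have h5 := congrArg (fun a : 𝓜(ℂ, C) => star s * a.fst s) h4
      have h7 : star (1 - T * T) = 1 - T * T := by simp [hTs]
      have h8 : star (b.fst v) * T.fst s = star s * ((1 - T * T) * b * T).fst s := by
        rw [star_fst_mul', hb.star_eq, hv, star_fst_mul', h7]; rfl
      have h9 : star (T.fst s) * b.fst v = star s * (T * b * (1 - T * T)).fst s := by
        rw [star_fst_mul', hTs]; rfl
      have h10 : star (T.fst s) * (T * b + b * T).fst (T.fst s) =
          star s * (T * (T * b + b * T) * T).fst s := by
        rw [star_fst_mul', hTs]; rfl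
      rw [star_smul, star_trivial, smul_mul_assoc, mul_smul_comm, ← smul_add, h8, h9, h10,
        ← mul_sub, ← mul_add]
      exact congrArg _ h5
    have h4 : (2 * N) • (star s * (T * b + b * T).fst s -
          star (T.fst s) * (T * b + b * T).fst (T.fst s)) ≤ κ • (star v * v) := by
      rw [← h3]
      refine le_of_tendsto h2 (Eventually.of_forall fun n => ?_)
      refine star_mul_apply_le ?_ (h n) v
      rw [IsSelfAdjoint, star_add, star_mul, star_mul, hb.star_eq,
        (hD.isSelfAdjoint_ratBCF n).star_eq, add_comm]
    -- This is `(1 - T²)² ≤ 1 - T²`, the difference being `T² - T⁴ ≥ 0` because `‖T‖ ≤ 1`.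
    have h5 : star v * v ≤ star s * s - star (T.fst s) * T.fst s := by
      have h6 := star_apply_mul_apply_le (hD.norm_tauBCF_le N) (T.fst s)
      rw [← hT] at h6
      have h7 : star v * v = star s * s - star (T.fst s) * T.fst s -
          (star (T.fst s) * T.fst s - star (T.fst (T.fst s)) * T.fst (T.fst s)) := by
        have e1 : star (T.fst s) * T.fst s = star s * T.fst (T.fst s) := by
          rw [star_fst_mul', hTs]
        have e2 : star (T.fst (T.fst s)) * s = star s * T.fst (T.fst s) := by
          rw [star_fst_mul', star_fst_mul', hTs]
        have e3 : v = s - T.fst (T.fst s) := rfl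
        rw [e3, e1, star_sub, sub_mul, mul_sub, mul_sub, e2]
      rw [h7]
      exact sub_le_self _ (sub_nonneg.2 h6)
    have h6 := smul_le_smul_of_nonneg_left (h4.trans (smul_le_smul_of_nonneg_left h5 hκ))
      (by positivity : 0 ≤ (2 * N)⁻¹)
    rw [smul_smul, inv_mul_cancel₀ (by positivity), one_smul, smul_smul, smul_sub,
      inv_mul_eq_div] at h6
    change (κ / (2 * N)) • _ - _ ≤ (κ / (2 * N)) • _ - _
    rw [← sub_nonneg] at h6 ⊢
    refine h6.trans_eq ?_
    abel
  have hiter : ∀ n, p ((hD.bddCalc (tauBCF N ^ n)).fst s) ≤ p s := by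
    intro n
    induction n with
    | zero => simp
    | succ n ih =>
      rw [pow_succ', hD.bddCalc_mul_apply]
      exact (hstep _).trans ih
  have hlim := (hp.tendsto 0).comp (hD.tendsto_tau_pow hN s)
  have := le_of_tendsto hlim (Eventually.of_forall hiter)
  have h0 : p 0 = 0 := by simp [p]
  rw [h0] at this
  exact sub_nonneg.1 this

/-- If the graded commutators of `b` with the bounded rational approximants of `D` are uniformly
bounded, then so are those with the approximants `i_N(D)`. -/
lemma norm_approximant_anticommutator_le (hD : IsEssSelfAdjointMultiplier D)
    {b : 𝓜(ℂ, C)} (hb : IsSelfAdjoint b) {κ : ℝ}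
    (h : ∀ n, ‖hD.bddCalc (ratBCF n) * b + b * hD.bddCalc (ratBCF n)‖ ≤ κ) {N : ℝ} (hN : 0 < N) :
    ‖approximant D N * b + b * approximant D N‖ ≤ 12 * κ := by
  let _ := CStarAlgebra.spectralOrder C
  have := CStarAlgebra.spectralOrderedRing C
  have hκ : 0 ≤ κ := (norm_nonneg _).trans (h 0)
  set T := hD.bddCalc (tauBCF N) with hT
  have hTs : star T = T := hD.isSelfAdjoint_tauBCF N
  have hT1 : ‖T‖ ≤ 1 := hD.norm_tauBCF_le N
  set z := T * b + b * T with hz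
  have hzs : IsSelfAdjoint z := by
    rw [IsSelfAdjoint, hz, star_add, star_mul, star_mul, hb.star_eq, hTs, add_comm]
  -- The one-sided form bound is used for `b` and for `-b`.
  have hzn : ‖z‖ ≤ 6 * (κ / (2 * N)) := by
    refine norm_le_of_quadratic_form hzs (by positivity) (hD.quadratic_form_le hb h hN) fun s => ?_
    have h1 := hD.quadratic_form_le hb.neg (κ := κ) (fun n => ?_) hN s
    · have h2 : hD.bddCalc (tauBCF N) * -b + -b * hD.bddCalc (tauBCF N) = -z := by
        rw [hz, hT]; noncomm_ring
      rw [h2] at h1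
      simpa using h1
    · have h2 : hD.bddCalc (ratBCF n) * -b + -b * hD.bddCalc (ratBCF n) =
          -(hD.bddCalc (ratBCF n) * b + b * hD.bddCalc (ratBCF n)) := by noncomm_ring
      rw [h2, norm_neg]
      exact h n
  set m := hD.bddCalc (invOneAddTauSqBCF N) with hm
  have hm1 : ‖m‖ ≤ 1 := (hD.norm_bddCalc_le _).trans norm_realBCF_le
  have hA1 : approximant D N = ((2 * N : ℝ) : ℂ) • (m * T) := by
    rw [hD.approximant_eq hN, hm, hT, ← map_mul, ← map_smul]
    congr 1
    ext x
    have := iN_eq_tau (N := N) x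
    simp only [BoundedContinuousFunction.coe_mul, Pi.mul_apply, BoundedContinuousFunction.coe_smul,
      smul_eq_mul, iNBCF, tauBCF, invOneAddTauSqBCF, realBCF_apply]
    norm_cast
    rw [this]
    ring
  have hmT : m * T = T * m := by rw [hm, hT, ← map_mul, mul_comm, map_mul]
  have hm2 : m * (1 + T * T) = 1 := by
    rw [hm, hT, ← map_mul, ← map_one hD.bddCalc, ← map_add, ← map_mul]
    congr 1
    ext x
    have := inv_one_add_tau_sq (N := N) x
    simp only [BoundedContinuousFunction.coe_mul, Pi.mul_apply, BoundedContinuousFunction.coe_add,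
      Pi.add_apply, BoundedContinuousFunction.coe_one, Pi.one_apply, tauBCF, invOneAddTauSqBCF,
      realBCF_apply]
    norm_cast
    linear_combination this
  have hm3 : (1 + T * T) * m = 1 := by
    have hc : Commute T m := hmT.symm
    exact ((Commute.one_left m).add_left (hc.mul_left hc)).eq.trans hm2
  -- With `m = (1 + T²)⁻¹`, inserting `(1 + T²)m = 1` on the right of one term and `m(1 + T²) = 1`
  -- on the left of the other gives a common sandwich by `m`.
  have hkey : approximant D N * b + b * approximant D N =
      ((2 * N : ℝ) : ℂ) • (m * (z + T * z * T) * m) := by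
    rw [hA1, smul_mul_assoc, mul_smul_comm, ← smul_add]
    congr 1
    calc m * T * b + b * (m * T)
        = m * T * b * ((1 + T * T) * m) + m * (1 + T * T) * b * (m * T) := by
          rw [hm2, hm3, mul_one, one_mul]
      _ = m * T * b * ((1 + T * T) * m) + m * (1 + T * T) * b * (T * m) := by rw [hmT]
      _ = m * (z + T * z * T) * m := by rw [hz]; noncomm_ring
  have h1 : ‖T * z * T‖ ≤ ‖z‖ := by
    calc ‖T * z * T‖ ≤ ‖T‖ * ‖z‖ * ‖T‖ := norm_mul₃_le
      _ ≤ 1 * ‖z‖ * 1 := by gcongr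
      _ = ‖z‖ := by ring
  have h2 : ‖m * (z + T * z * T) * m‖ ≤ 2 * ‖z‖ := by
    calc ‖m * (z + T * z * T) * m‖ ≤ ‖m‖ * ‖z + T * z * T‖ * ‖m‖ := norm_mul₃_le
      _ ≤ 1 * (‖z‖ + ‖z‖) * 1 := by
        gcongr
        exact (norm_add_le _ _).trans (by linarith)
      _ = 2 * ‖z‖ := by ring
  rw [hkey, norm_smul, Complex.norm_real, Real.norm_of_nonneg (by positivity)]
  -- The prefactor `2N` cancels the `1/(2N)` in the bound for `z`, so the estimate is uniform in
  -- `N`.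
  calc 2 * N * ‖m * (z + T * z * T) * m‖ ≤ 2 * N * (2 * (6 * (κ / (2 * N)))) := by
        gcongr
        linarith
    _ = 12 * κ := by field_simp; ring

end IsEssSelfAdjointMultiplier

/-! ### Commutators on an invariant core -/

lemma add_I_mul_ne_zero {l : ℝ} (hl : l ≠ 0) (x : ℝ) : (x : ℂ) + Complex.I * l ≠ 0 := by
  intro h
  have := congrArg Complex.im h
  simp at this
  exact hl this

/-- The bounded function `x ↦ (x + i l)⁻¹`. -/
noncomputable def resBCF (l : ℝ) (hl : l ≠ 0) : ℝ →ᵇ ℂ :=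
  .ofNormedAddCommGroup (fun x : ℝ => ((x : ℂ) + Complex.I * l)⁻¹)
    (Continuous.inv₀ (by fun_prop) (add_I_mul_ne_zero hl)) |l|⁻¹ fun x => by
      rw [norm_inv]
      refine inv_anti₀ (abs_pos.2 hl) ?_
      have := Complex.abs_im_le_norm ((x : ℂ) + Complex.I * l)
      simpa using this

lemma resBCF_apply {l : ℝ} (hl : l ≠ 0) (x : ℝ) :
    resBCF l hl x = ((x : ℂ) + Complex.I * l)⁻¹ := rfl

lemma norm_resBCF_le {l : ℝ} (hl : l ≠ 0) : ‖resBCF l hl‖ ≤ |l|⁻¹ :=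
  BoundedContinuousFunction.norm_ofNormedAddCommGroup_le _ (by positivity) _

/-- Partial fractions at the poles `±i l`; this reduces commutators with the approximant to
resolvent commutators. -/
lemma ratBCF_eq (n : ℕ) (h1 : (n : ℝ) + 1 ≠ 0) (h2 : -((n : ℝ) + 1) ≠ 0) :
    ratBCF n = ((((n : ℝ) + 1) ^ 2 / 2 : ℝ) : ℂ) •
      (resBCF ((n : ℝ) + 1) h1 + resBCF (-((n : ℝ) + 1)) h2) := by
  ext x
  have h3 := add_I_mul_ne_zero h1 x
  have h4 := add_I_mul_ne_zero h2 x
  have h5 : ((x : ℂ) ^ 2 + ((n : ℂ) + 1) ^ 2) ≠ 0 := by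
    have : x ^ 2 + ((n : ℝ) + 1) ^ 2 ≠ 0 := by positivity
    exact_mod_cast this
  simp only [ratBCF, realBCF_apply, BoundedContinuousFunction.coe_smul, smul_eq_mul,
    BoundedContinuousFunction.coe_add, Pi.add_apply, resBCF_apply]
  push_cast at h3 h4 ⊢
  have h6 : ((x : ℂ) + Complex.I * (n + 1)) * (x + Complex.I * -(n + 1)) =
      x ^ 2 + ((n : ℂ) + 1) ^ 2 := by
    linear_combination -((n : ℂ) + 1) ^ 2 * Complex.I_sq
  have h7 : ((x : ℂ) + Complex.I * (n + 1))⁻¹ + (x + Complex.I * -(n + 1))⁻¹ =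
      2 * x / (x ^ 2 + ((n : ℂ) + 1) ^ 2) := by
    rw [← h6, inv_add_inv h3 h4]
    congr 1
    ring
  rw [h7]
  field_simp

lemma IsEssSelfAdjointMultiplier.bddCalc_resBCF_apply {D : C →ₗ.[ℂ] C}
    (hD : IsEssSelfAdjointMultiplier D) {l : ℝ} (hl : l ≠ 0) {c d : C}
    (h : (c, d) ∈ D.closure.graph) :
    (hD.bddCalc (resBCF l hl)).fst (d + (Complex.I * l) • c) = c := by
  have h1 := hD.bddCalc_apply_of_mem_graph (φ := resBCF l hl)
    (ψ := 1 - (Complex.I * l) • resBCF l hl) (fun x => by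
      have := add_I_mul_ne_zero hl x
      simp only [BoundedContinuousFunction.coe_sub, Pi.sub_apply,
        BoundedContinuousFunction.coe_one, Pi.one_apply, BoundedContinuousFunction.coe_smul,
        smul_eq_mul, resBCF_apply]
      field_simp
      ring) h
  rw [hD.bddCalc_sub_apply, hD.bddCalc_smul_apply, map_one] at h1
  rw [map_add, map_smul, ← h1]
  simp

/-- The operator `D` maps `S` to itself by `δ`, and `D² + l²` maps `S` onto itself. -/
structure IsInvariantCore (D : C →ₗ.[ℂ] C) (S : Submodule ℂ C) (δ : S →ₗ[ℂ] S) : Prop where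
  mem_graph : ∀ c : S, ((c : C), (δ c : C)) ∈ D.closure.graph
  exists_solution : ∀ l : ℝ, 0 < l → ∀ c : S, ∃ d : S, δ (δ d) + ((l ^ 2 : ℝ) : ℂ) • d = c

namespace IsInvariantCore

variable {D : C →ₗ.[ℂ] C} {S : Submodule ℂ C} {δ : S →ₗ[ℂ] S}

/-- The resolvent preserves `S` because `(D + il)⁻¹ = (D - il)(D² + l²)⁻¹`, and both factors act on
`S`. -/
lemma exists_resolvent (h : IsInvariantCore D S δ) (hD : IsEssSelfAdjointMultiplier D)
    {l : ℝ} (hl : l ≠ 0) (c : S) :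
    ∃ e : S, (e : C) = (hD.bddCalc (resBCF l hl)).fst c ∧ δ e + (Complex.I * l) • e = c := by
  obtain ⟨d, hd⟩ := h.exists_solution |l| (abs_pos.2 hl) c
  have h1 : δ (δ d - (Complex.I * l) • d) + (Complex.I * l) • (δ d - (Complex.I * l) • d) = c := by
    rw [← hd, map_sub, map_smul, smul_sub, smul_smul, sq_abs]
    have : Complex.I * l * (Complex.I * l) = -((l ^ 2 : ℝ) : ℂ) := by
      push_cast
      linear_combination (l : ℂ) ^ 2 * Complex.I_sq
    rw [this, neg_smul]
    abel
  refine ⟨_, ?_, h1⟩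
  have h2 := hD.bddCalc_resBCF_apply hl (h.mem_graph (δ d - (Complex.I * l) • d))
  rw [← h2]
  congr 1
  exact congrArg Subtype.val h1

/-- Passing `η` through a resolvent flips the sign of `l`, since the commutator is graded: `R_l η +
η R_{-l} = R_l (Dη + ηD) R_{-l}`, here applied to `c` with `e = R_{-l} c`. -/
lemma resolvent_commutator (h : IsInvariantCore D S δ) (hD : IsEssSelfAdjointMultiplier D)
    {η : S →ₗ[ℂ] S} {B : C →L[ℂ] C} (hB : ∀ c : S, B c = δ (η c) + η (δ c))
    {l : ℝ} (hl : l ≠ 0) {c e : S}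
    (he : δ e + (Complex.I * (-l : ℝ)) • e = c) :
    (hD.bddCalc (resBCF l hl)).fst (η c) + η e = (hD.bddCalc (resBCF l hl)).fst (B e) := by
  have h1 := hD.bddCalc_resBCF_apply hl (h.mem_graph (η e))
  conv_lhs => rw [← h1]
  rw [← map_add]
  congr 1
  rw [hB, ← he, map_add, map_smul]
  push_cast
  module

/-- The bounded rational approximants of `D` preserve `S`, and their graded commutators with an
operator on `S` are controlled by that of `D`. -/
lemma exists_rat_commutator (h : IsInvariantCore D S δ) (hD : IsEssSelfAdjointMultiplier D)
    {η : S →ₗ[ℂ] S} {B : C →L[ℂ] C} (hB : ∀ c : S, B c = δ (η c) + η (δ c)) (n : ℕ) :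
    ∃ (G : S →ₗ[ℂ] S) (W : C →L[ℂ] C), ‖W‖ ≤ ‖B‖ ∧
      (∀ c : S, (G c : C) = (hD.bddCalc (ratBCF n)).fst c) ∧
      ∀ c : S, W c = (hD.bddCalc (ratBCF n)).fst (η c) + η (G c) := by
  set l : ℝ := (n : ℝ) + 1 with hl
  have hl0 : 0 < l := by positivity
  have h1 : l ≠ 0 := hl0.ne'
  have h2 : -l ≠ 0 := neg_ne_zero.2 h1
  set k : ℂ := ((l ^ 2 / 2 : ℝ) : ℂ) with hk
  have hrat : ∀ c : C, (hD.bddCalc (ratBCF n)).fst c =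
      k • ((hD.bddCalc (resBCF l h1)).fst c + (hD.bddCalc (resBCF (-l) h2)).fst c) := fun c => by
    rw [ratBCF_eq n h1 h2, hD.bddCalc_smul_apply, hD.bddCalc_add_apply]
  have hmem : ∀ c : S, (hD.bddCalc (ratBCF n)).fst c ∈ S := fun c => by
    obtain ⟨e, he, -⟩ := h.exists_resolvent hD h1 c
    obtain ⟨e', he', -⟩ := h.exists_resolvent hD h2 c
    rw [hrat, ← he, ← he']
    exact S.smul_mem _ (S.add_mem e.2 e'.2)
  let G : S →ₗ[ℂ] S := (hD.bddCalc (ratBCF n)).fst.toLinearMap.restrict fun c hc => hmem ⟨c, hc⟩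
  have hG : ∀ c : S, (G c : C) = (hD.bddCalc (ratBCF n)).fst c := fun c => rfl
  set P := (hD.bddCalc (resBCF l h1)).fst with hP
  set Q := (hD.bddCalc (resBCF (-l) h2)).fst with hQ
  have hPn : ‖P‖ ≤ l⁻¹ := by
    rw [hP, DoubleCentralizer.norm_fst]
    exact (hD.norm_bddCalc_le _).trans ((norm_resBCF_le h1).trans_eq (by rw [abs_of_pos hl0]))
  have hQn : ‖Q‖ ≤ l⁻¹ := by
    rw [hQ, DoubleCentralizer.norm_fst]
    exact (hD.norm_bddCalc_le _).trans ((norm_resBCF_le h2).trans_eq (by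
      rw [abs_neg, abs_of_pos hl0]))
  -- Sum of the two resolvent commutators. Each resolvent has norm at most `1/l`, and `k = l²/2`
  -- makes the total exactly `‖B‖`.
  refine ⟨G, k • (P ∘L B ∘L Q + Q ∘L B ∘L P), ?_, hG, fun c => ?_⟩
  · have hc : ∀ U V : C →L[ℂ] C, ‖U‖ ≤ l⁻¹ → ‖V‖ ≤ l⁻¹ → ‖U ∘L B ∘L V‖ ≤ l⁻¹ * (‖B‖ * l⁻¹) :=
      fun U V hU hV => by
        refine (U.opNorm_comp_le _).trans ?_
        have := B.opNorm_comp_le V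
        gcongr
        exact this.trans (by gcongr)
    calc ‖k • (P ∘L B ∘L Q + Q ∘L B ∘L P)‖
        ≤ ‖k‖ * (‖P ∘L B ∘L Q‖ + ‖Q ∘L B ∘L P‖) := by
          rw [norm_smul]
          gcongr
          exact norm_add_le _ _
      _ ≤ (l ^ 2 / 2) * (l⁻¹ * (‖B‖ * l⁻¹) + l⁻¹ * (‖B‖ * l⁻¹)) := by
          rw [hk, Complex.norm_real, Real.norm_of_nonneg (by positivity)]
          gcongr
          · exact hc P Q hPn hQn
          · exact hc Q P hQn hPn
      _ = ‖B‖ := by field_simp; ring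
  · obtain ⟨e, he, he2⟩ := h.exists_resolvent hD h1 c
    obtain ⟨e', he', he2'⟩ := h.exists_resolvent hD h2 c
    have h3 := h.resolvent_commutator hD hB h1 he2'
    have h4 := h.resolvent_commutator hD hB h2 (c := c) (e := e)
      (by rw [neg_neg]; exact he2)
    have h5 : G c = k • (e + e') := by
      apply Subtype.ext
      rw [hG, hrat, Submodule.coe_smul, Submodule.coe_add, he, he']
    change k • (P (B (Q c)) + Q (B (P c))) = _
    rw [hrat, h5, map_smul, map_add, Submodule.coe_smul, Submodule.coe_add, ← he, ← he', ← h3,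
      ← h4]
    module

/-- The approximants of two operators with small commutator on a common invariant core have small
graded commutator. -/
lemma norm_approximant_commutator_le {D' : C →ₗ.[ℂ] C} {δ' : S →ₗ[ℂ] S}
    (h : IsInvariantCore D S δ) (h' : IsInvariantCore D' S δ')
    (hD : IsEssSelfAdjointMultiplier D) (hD' : IsEssSelfAdjointMultiplier D')
    (hS : Dense (S : Set C)) {B : C →L[ℂ] C} (hB : ∀ c : S, B c = δ (δ' c) + δ' (δ c))
    {N : ℝ} (hN : 0 < N) :
    ‖approximant D N * approximant D' N + approximant D' N * approximant D N‖ ≤ 144 * ‖B‖ := by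
  have hrat : ∀ n m, ‖hD.bddCalc (ratBCF n) * hD'.bddCalc (ratBCF m) +
      hD'.bddCalc (ratBCF m) * hD.bddCalc (ratBCF n)‖ ≤ ‖B‖ := by
    intro n m
    obtain ⟨G, W, hW, hG, hGW⟩ := h.exists_rat_commutator hD hB n
    -- The bounded commutator of `D'` with the approximant `G` of `D` now plays the role of the
    -- original commutator.
    obtain ⟨G', W', hW', hG', hGW'⟩ := h'.exists_rat_commutator hD' (η := G) (B := W)
      (fun c => by rw [hGW, hG, add_comm]) m
    have h1 : (hD.bddCalc (ratBCF n) * hD'.bddCalc (ratBCF m) +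
        hD'.bddCalc (ratBCF m) * hD.bddCalc (ratBCF n)).fst = W' := by
      refine ContinuousLinearMap.ext fun c => ?_
      refine congrFun (Continuous.ext_on hS (ContinuousLinearMap.continuous _)
        W'.continuous fun c hc => ?_) c
      have h2 := hGW' ⟨c, hc⟩
      rw [hG, hG, hG'] at h2
      rw [h2, add_comm]
      rfl
    rw [← DoubleCentralizer.norm_fst, h1]
    exact hW'.trans hW
  have h1 : ∀ m, ‖approximant D N * hD'.bddCalc (ratBCF m) +
      hD'.bddCalc (ratBCF m) * approximant D N‖ ≤ 12 * ‖B‖ := fun m =>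
    hD.norm_approximant_anticommutator_le (hD'.isSelfAdjoint_ratBCF m) (fun n => hrat n m) hN
  have h2 : IsSelfAdjoint (approximant D N) := by
    rw [hD.approximant_eq hN]
    exact hD.isSelfAdjoint_bddCalc fun x => star_realBCF x
  -- Each passage from rational approximants to `i_N` costs a factor `12`, once for `D` and once for
  -- `D'`: hence `144`.
  have h3 := hD'.norm_approximant_anticommutator_le h2 (κ := 12 * ‖B‖)
    (fun m => by rw [add_comm]; exact h1 m) hN
  rw [add_comm]
  linarith

end IsInvariantCore

/-! ### The resolvent estimate -/

lemma norm_one_multiplier_le : ‖(1 : 𝓜(ℂ, C))‖ ≤ 1 :=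
  norm_multiplier_le _ zero_le_one fun c => by simp

/-- If `a b + b a ≥ -1`, then `a` is relatively bounded by `a + b`. -/
lemma norm_inv_mul_le {a b V : 𝓜(ℂ, C)} (ha : IsSelfAdjoint a) (hb : IsSelfAdjoint b)
    (hab : ‖a * b + b * a‖ ≤ 1) (hV : V * (a + b + algebraMap ℂ _ Complex.I) = 1) :
    ‖V * a‖ ≤ 1 := by
  let _ := CStarAlgebra.spectralOrder 𝓜(ℂ, C)
  have := CStarAlgebra.spectralOrderedRing 𝓜(ℂ, C)
  set J : 𝓜(ℂ, C) := algebraMap ℂ _ Complex.I with hJ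
  have hJs : star J = -J := by
    rw [hJ, ← algebraMap_star_comm]; simp
  have hJ2 : J * J = -1 := by
    rw [hJ, ← map_mul, Complex.I_mul_I]; simp
  have hJc : ∀ x, J * x = x * J := fun x => Algebra.commutes _ _
  set X := a + b with hX
  have hXs : star X = X := (ha.add hb).star_eq
  have h1 : (X + J) * star (X + J) = X * X + 1 := by
    have h : (X + J) * (X + -J) = X * X + (J * X - X * J) - J * J := by noncomm_ring
    rw [star_add, hXs, hJs, h, hJc, hJ2, sub_self, add_zero, sub_neg_eq_add]
  have h2 : V * (X * X + 1) * star V = 1 := by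
    rw [← h1, ← mul_assoc, hV, one_mul, ← star_mul, hV, star_one]
  have hs : IsSelfAdjoint (a * b + b * a) := by
    rw [IsSelfAdjoint, star_add, star_mul, star_mul, ha.star_eq, hb.star_eq, add_comm]
  have h3 : -1 ≤ a * b + b * a := by
    have h4 := hs.neg.le_algebraMap_norm_self.trans
      (algebraMap_mono 𝓜(ℂ, C) (by rw [norm_neg]; exact hab : ‖-(a * b + b * a)‖ ≤ 1))
    rw [map_one] at h4
    exact neg_le.1 h4
  -- The difference is `b² + (ab + ba + 1)`, a sum of two positive elements.
  have h4 : a * a ≤ X * X + 1 := by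
    have h5 : X * X + 1 = a * a + (b * b + ((a * b + b * a) - (-1))) := by
      rw [hX]; noncomm_ring
    rw [h5]
    refine le_add_of_nonneg_right (add_nonneg ?_ (sub_nonneg.2 h3))
    have := star_mul_self_nonneg b
    rwa [hb.star_eq] at this
  -- Conjugation by `V` turns `X² + 1 = (X + i)(X + i)⋆` into `1` and `a²` into `(Va)(Va)⋆`.
  have h5 := star_right_conjugate_le_conjugate h4 V
  rw [h2] at h5
  have h6 : V * (a * a) * star V = (V * a) * star (V * a) := by
    rw [star_mul, ha.star_eq]; simp only [mul_assoc]
  rw [h6] at h5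
  have h7 := CStarAlgebra.norm_le_norm_of_nonneg_of_le (mul_star_self_nonneg _) h5
  rw [CStarRing.norm_self_mul_star] at h7
  have h8 := h7.trans norm_one_multiplier_le
  nlinarith [norm_nonneg (V * a)]

lemma isSelfAdjoint_approximant {D : C →ₗ.[ℂ] C} (hD : IsEssSelfAdjointMultiplier D) {N : ℝ}
    (hN : 0 < N) : IsSelfAdjoint (approximant D N) := by
  rw [hD.approximant_eq hN]
  exact hD.isSelfAdjoint_bddCalc fun x => star_realBCF x

/-- From `x - i_N(x) = (1 - cos θ) x = N⁻¹ i_N(x) τ(x) x`. The factor `D_N` is kept separate because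
the resolvent of `D_N + D'_N` absorbs it. -/
lemma sub_approximant_apply {D : C →ₗ.[ℂ] C} (hD : IsEssSelfAdjointMultiplier D) {N : ℝ}
    (hN : 0 < N) {c d : C} (h : (c, d) ∈ D.closure.graph) :
    d - (approximant D N).fst c =
      ((N⁻¹ : ℝ) : ℂ) • (approximant D N).fst ((hD.bddCalc (tauBCF N)).fst d) := by
  have h1 : (approximant D N).fst c = (hD.bddCalc (cosBCF N)).fst d := by
    rw [hD.approximant_eq hN]
    refine hD.bddCalc_apply_of_mem_graph (fun x => ?_) h
    simp only [iNBCF, cosBCF, realBCF_apply]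
    norm_cast
    field_simp
  have h2 : 1 - cosBCF N = ((N⁻¹ : ℝ) : ℂ) • (iNBCF N * tauBCF N) := by
    ext x
    have := one_sub_cos x hN
    simp only [BoundedContinuousFunction.coe_sub, Pi.sub_apply, BoundedContinuousFunction.coe_one,
      Pi.one_apply, BoundedContinuousFunction.coe_smul, smul_eq_mul,
      BoundedContinuousFunction.coe_mul, Pi.mul_apply, cosBCF, iNBCF, tauBCF, realBCF_apply]
    exact_mod_cast this
  have h3 := congrArg (fun φ => (hD.bddCalc φ).fst d) h2
  simp only [hD.bddCalc_sub_apply, hD.bddCalc_smul_apply, hD.bddCalc_mul_apply, map_one] at h3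
  rw [h1, hD.approximant_eq hN, ← h3]
  simp

/-- Expand `(x + y)⋆(x + y)` and drop `y⋆y`. With `x = Dc`, `y = D'c`, the cross terms are the
commutator form `c⋆[D, D']c`, so `D` is relatively bounded by `D + D'`. -/
lemma norm_sq_add_le_of_symm {x y c m : C} (h : star x * y + star y * x = star c * m) :
    ‖x‖ ^ 2 ≤ ‖x + y‖ ^ 2 + ‖c‖ * ‖m‖ := by
  let _ := CStarAlgebra.spectralOrder C
  have := CStarAlgebra.spectralOrderedRing C
  have h1 : star x * x ≤ star (x + y) * (x + y) - star c * m := by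
    have h2 : star (x + y) * (x + y) - star c * m = star x * x + star y * y := by
      rw [← h, star_add, add_mul, mul_add, mul_add]; abel
    rw [h2]
    exact le_add_of_nonneg_right (star_mul_self_nonneg y)
  have h2 := CStarAlgebra.norm_le_norm_of_nonneg_of_le (star_mul_self_nonneg x) h1
  have h3 := h2.trans (norm_sub_le _ _)
  rw [CStarRing.norm_star_mul_self, CStarRing.norm_star_mul_self] at h3
  have h4 := norm_mul_le (star c) m
  rw [norm_star] at h4
  linarith

/-- The resolvents of `D_N + D'_N` and `D + D'` differ by `O(1/N)` if the commutator is small. -/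
lemma norm_inv_sub_resolvent_le {D D' : C →ₗ.[ℂ] C} {S : Submodule ℂ C} {δ δ' : S →ₗ[ℂ] S}
    (h : IsInvariantCore D S δ) (h' : IsInvariantCore D' S δ')
    (hD : IsEssSelfAdjointMultiplier D) (hD' : IsEssSelfAdjointMultiplier D')
    (hT : IsEssSelfAdjointMultiplier (D + D')) (hS : Dense (S : Set C))
    (hδ : ∀ c : S, ((c : C), (δ c : C) + δ' c) ∈ (D + D').closure.graph)
    (hcore : ∀ p ∈ (D + D').closure.graph,
      p ∈ closure (Set.range fun c : S => ((c : C), (δ c : C) + δ' c)))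
    {B : C →L[ℂ] C} (hB : ∀ c : S, B c = δ (δ' c) + δ' (δ c)) (hB1 : 144 * ‖B‖ ≤ 1)
    {N : ℝ} (hN : 0 < N) {V : 𝓜(ℂ, C)}
    (hV : V * (approximant D N + approximant D' N + algebraMap ℂ _ Complex.I) = 1) :
    ‖V - resolvent (D + D') Complex.I‖ ≤ 6 / N := by
  set a := approximant D N with ha
  set b := approximant D' N with hb
  have hab : ‖a * b + b * a‖ ≤ 1 :=
    (h.norm_approximant_commutator_le h' hD hD' hS hB hN).trans hB1
  have has := isSelfAdjoint_approximant hD hN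
  have hbs := isSelfAdjoint_approximant hD' hN
  have hVa : ‖V * a‖ ≤ 1 := norm_inv_mul_le has hbs hab hV
  have hVb : ‖V * b‖ ≤ 1 := norm_inv_mul_le hbs has (by rwa [add_comm]) (by rwa [add_comm b])
  set R := resolvent (D + D') Complex.I with hR
  -- The estimate is first proved at vectors `e = (D + D' + i)c` with `c` in the core, where `D` and
  -- `D'` can be applied separately.
  have hcoreBound : ∀ c : S, ‖(V - R).fst ((δ c : C) + δ' c + Complex.I • (c : C))‖ ≤
      6 / N * ‖(δ c : C) + δ' c + Complex.I • (c : C)‖ := by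
    intro c
    set e : C := (δ c : C) + δ' c + Complex.I • (c : C) with he
    have hRe : R.fst e = c := hT.resolvent_unique (by simp) (by simp) (by
      rw [he, add_sub_cancel_right]; exact hδ c)
    have hc : ‖(c : C)‖ ≤ ‖e‖ := hT.closure_selfAdjoint.norm_le (by simp) (by simp) (hδ c)
    have hTc : ‖(δ c : C) + δ' c‖ ≤ 2 * ‖e‖ := by
      have h1 : (δ c : C) + δ' c = e - Complex.I • (c : C) := by rw [he, add_sub_cancel_right]
      rw [h1]
      refine (norm_sub_le _ _).trans ?_
      rw [norm_smul, Complex.norm_I]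
      linarith
    have hBc : ‖(c : C)‖ * ‖B c‖ ≤ ‖e‖ ^ 2 := by
      have h1 : ‖B c‖ ≤ 1 * ‖(c : C)‖ :=
        (B.le_opNorm _).trans (by gcongr; linarith [norm_nonneg B])
      nlinarith [norm_nonneg (c : C), norm_nonneg (B c)]
    have hsym : star (δ c : C) * δ' c + star (δ' c : C) * δ c = star (c : C) * B c := by
      have h1 := (hD.closure_selfAdjoint.mem_graph_iff _ _).1 (h.mem_graph (δ' c)) _ _ (h.mem_graph c)
      have h2 := (hD'.closure_selfAdjoint.mem_graph_iff _ _).1 (h'.mem_graph (δ c)) _ _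
        (h'.mem_graph c)
      rw [h1, h2, hB, mul_add]
    -- The right-hand side is at most `(2‖e‖)² + ‖e‖² = 5‖e‖²`, rounded up to `9‖e‖²`.
    have hbound : ∀ x : C, ‖x‖ ^ 2 ≤ ‖(δ c : C) + δ' c‖ ^ 2 + ‖(c : C)‖ * ‖B c‖ → ‖x‖ ≤ 3 * ‖e‖ := by
      intro x hx
      refine (sq_le_sq₀ (norm_nonneg _) (by positivity)).1 ?_
      nlinarith [norm_nonneg ((δ c : C) + δ' c), norm_nonneg e]
    have hx := hbound _ (norm_sq_add_le_of_symm hsym)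
    have hy := hbound (δ' c) (by
      have := norm_sq_add_le_of_symm (x := (δ' c : C)) (y := δ c) (c := (c : C)) (m := B c)
        (by rw [add_comm]; exact hsym)
      rwa [add_comm (δ' c : C)] at this)
    have hterm : ∀ {E : C →ₗ.[ℂ] C} (hE : IsEssSelfAdjointMultiplier E) {d : C},
        ((c : C), d) ∈ E.closure.graph → ‖V * approximant E N‖ ≤ 1 → ‖d‖ ≤ 3 * ‖e‖ →
        ‖V.fst (d - (approximant E N).fst c)‖ ≤ 3 / N * ‖e‖ := by
      intro E hE d hd hVE hde
      rw [sub_approximant_apply hE hN hd, map_smul, norm_smul, Complex.norm_real,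
        Real.norm_of_nonneg (by positivity)]
      have h1 := norm_multiplier_apply_le (V * approximant E N) ((hE.bddCalc (tauBCF N)).fst d)
      have h2 := norm_multiplier_apply_le (hE.bddCalc (tauBCF N)) d
      have h3 : ‖(hE.bddCalc (tauBCF N)).fst d‖ ≤ 3 * ‖e‖ :=
        h2.trans ((mul_le_of_le_one_left (norm_nonneg _) (hE.norm_tauBCF_le N)).trans hde)
      have h4 : ‖V.fst ((approximant E N).fst ((hE.bddCalc (tauBCF N)).fst d))‖ ≤ 3 * ‖e‖ :=
        h1.trans ((mul_le_of_le_one_left (norm_nonneg _) hVE).trans h3)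
      calc N⁻¹ * _ ≤ N⁻¹ * (3 * ‖e‖) := by gcongr
        _ = 3 / N * ‖e‖ := by ring
    have hVc : (c : C) = V.fst (a.fst c + b.fst c + Complex.I • (c : C)) := by
      have := congrArg (fun x : 𝓜(ℂ, C) => x.fst (c : C)) hV
      simp only [Algebra.algebraMap_eq_smul_one] at this
      exact this.symm
    -- The second resolvent identity: write `R e = c = V(a + b + i)c`, so the terms in `i` cancel.
    have hdiff : (V - R).fst e = V.fst ((δ c : C) - a.fst c) + V.fst ((δ' c : C) - b.fst c) := by
      have h1 : (V - R).fst e = V.fst e - R.fst e := rfl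
      rw [h1, hRe]
      conv_lhs => rw [hVc]
      rw [← map_sub, ← map_add]
      congr 1
      rw [he]
      abel
    rw [hdiff]
    refine (norm_add_le _ _).trans ?_
    have h1 := hterm hD (h.mem_graph c) hVa hx
    have h2 := hterm hD' (h'.mem_graph c) hVb hy
    calc _ ≤ 3 / N * ‖e‖ + 3 / N * ‖e‖ := add_le_add h1 h2
      _ = 6 / N * ‖e‖ := by ring
  refine norm_multiplier_le _ (by positivity) fun e₀ => ?_
  -- Any vector is `(D + D' + i)R e₀`; core pairs approximate its graph point, and the estimate is a
  -- closed condition on the graph.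
  have hmem := hcore _ (hT.resolvent_mem (s := Complex.I) (by simp) (by simp) e₀)
  have hclosed : IsClosed {p : C × C | ‖(V - R).fst (p.2 + Complex.I • p.1)‖ ≤
      6 / N * ‖p.2 + Complex.I • p.1‖} := by
    have := (V - R).fst.continuous
    exact isClosed_le (by fun_prop) (by fun_prop)
  have := closure_minimal (Set.range_subset_iff.2 hcoreBound) hclosed hmem
  simpa using this

/-! ### Rescaling -/

lemma mem_smul_graph_iff {E : C →ₗ.[ℂ] C} {k : ℂ} (hk : k ≠ 0) {x y : C} :
    (x, y) ∈ (k • E).graph ↔ (x, k⁻¹ • y) ∈ E.graph := by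
  rw [LinearPMap.smul_graph, Submodule.mem_map]
  constructor
  · rintro ⟨⟨a, b⟩, h, hab⟩
    obtain ⟨rfl, rfl⟩ := Prod.ext_iff.1 hab
    change (a, k⁻¹ • k • b) ∈ E.graph
    rwa [inv_smul_smul₀ hk]
  · intro h
    refine ⟨_, h, Prod.ext rfl ?_⟩
    exact smul_inv_smul₀ hk y

lemma smul_closure_graph {E : C →ₗ.[ℂ] C} (hE : E.IsClosable) {k : ℂ} (hk : k ≠ 0) :
    (k • E).graph.topologicalClosure = (k • E.closure).graph := by
  let e : C × C ≃ₜ C × C :=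
    (Homeomorph.refl C).prodCongr (Homeomorph.smulOfNeZero k⁻¹ (inv_ne_zero hk))
  have h1 : ∀ F : C →ₗ.[ℂ] C, ((k • F).graph : Set (C × C)) = e ⁻¹' F.graph := fun F => by
    ext ⟨x, y⟩
    exact mem_smul_graph_iff hk
  apply SetLike.coe_injective
  rw [Submodule.topologicalClosure_coe, h1, h1, ← e.preimage_closure,
    ← hE.graph_closure_eq_closure_graph, Submodule.topologicalClosure_coe]

lemma isClosable_smul {E : C →ₗ.[ℂ] C} (hE : E.IsClosable) {k : ℂ} (hk : k ≠ 0) :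
    (k • E).IsClosable :=
  ⟨_, smul_closure_graph hE hk⟩

lemma mem_closure_smul_graph_iff {E : C →ₗ.[ℂ] C} (hE : E.IsClosable) {k : ℂ} (hk : k ≠ 0)
    {x y : C} : (x, y) ∈ (k • E).closure.graph ↔ (x, k⁻¹ • y) ∈ E.closure.graph := by
  rw [← (isClosable_smul hE hk).graph_closure_eq_closure_graph, smul_closure_graph hE hk,
    mem_smul_graph_iff hk]

/-- The function `(x² + l²)⁻¹`. -/
noncomputable def sqResBCF (l : ℝ) (hl : 0 < l) : ℝ →ᵇ ℂ :=
  realBCF (fun x => (x ^ 2 + l ^ 2)⁻¹) (Continuous.inv₀ (by fun_prop) fun x => by positivity)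
    (l ^ 2)⁻¹ fun x => by
      rw [abs_of_pos (by positivity)]
      exact inv_anti₀ (by positivity) (by nlinarith [sq_nonneg x])

/-- The function `x (x² + l²)⁻¹`. -/
noncomputable def mulSqResBCF (l : ℝ) (hl : 0 < l) : ℝ →ᵇ ℂ :=
  realBCF (fun x => x * (x ^ 2 + l ^ 2)⁻¹)
    (continuous_id.mul (Continuous.inv₀ (by fun_prop) fun x => by positivity))
    l⁻¹ fun x => by
      rw [abs_mul, abs_of_pos (a := (x ^ 2 + l ^ 2)⁻¹) (by positivity), ← div_eq_mul_inv,
        div_le_iff₀ (by positivity), inv_mul_eq_div, le_div_iff₀ hl]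
      nlinarith [sq_nonneg (|x| - l), sq_abs x, abs_nonneg x]

namespace IsEssSelfAdjointMultiplier

variable {D : C →ₗ.[ℂ] C}

/-- `D² + l²` is surjective. -/
lemma exists_sq_solution (hD : IsEssSelfAdjointMultiplier D) {l : ℝ} (hl : 0 < l) (a : C) :
    ∃ y z : C, ((hD.bddCalc (sqResBCF l hl)).fst a, y) ∈ D.closure.graph ∧
      (y, z) ∈ D.closure.graph ∧
      z + ((l ^ 2 : ℝ) : ℂ) • (hD.bddCalc (sqResBCF l hl)).fst a = a := by
  refine ⟨(hD.bddCalc (mulSqResBCF l hl)).fst a,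
    (hD.bddCalc (1 - ((l ^ 2 : ℝ) : ℂ) • sqResBCF l hl)).fst a,
    hD.bddCalc_mem_graph (fun x => ?_) a, hD.bddCalc_mem_graph (fun x => ?_) a, ?_⟩
  · simp [mulSqResBCF, sqResBCF]
  · have h : (1 : ℝ) - l ^ 2 * (x ^ 2 + l ^ 2)⁻¹ = x * (x * (x ^ 2 + l ^ 2)⁻¹) := by
      have : x ^ 2 + l ^ 2 ≠ 0 := by positivity
      field_simp
      ring
    simp only [BoundedContinuousFunction.coe_sub, Pi.sub_apply, BoundedContinuousFunction.coe_one,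
      Pi.one_apply, BoundedContinuousFunction.coe_smul, smul_eq_mul, mulSqResBCF, sqResBCF,
      realBCF_apply]
    exact_mod_cast h
  · rw [hD.bddCalc_sub_apply, hD.bddCalc_smul_apply, map_one]
    simp

/-- This is `cos² θ = 1 - sin² θ` with `x / l = tan θ`. It makes `(D² + l²)⁻¹` a polynomial in
`D_l`, so that a core invariant under `D_l` is invariant under it. -/
lemma sqResBCF_apply_eq (hD : IsEssSelfAdjointMultiplier D) {l : ℝ} (hl : 0 < l) (a : C) :
    (hD.bddCalc (sqResBCF l hl)).fst a = (((l ^ 2)⁻¹ : ℝ) : ℂ) •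
      (a - (((l ^ 2)⁻¹ : ℝ) : ℂ) • (approximant D l).fst ((approximant D l).fst a)) := by
  have h : sqResBCF l hl = (((l ^ 2)⁻¹ : ℝ) : ℂ) •
      (1 - (((l ^ 2)⁻¹ : ℝ) : ℂ) • (iNBCF l * iNBCF l)) := by
    ext x
    simp only [BoundedContinuousFunction.coe_sub, Pi.sub_apply, BoundedContinuousFunction.coe_one,
      Pi.one_apply, BoundedContinuousFunction.coe_smul, smul_eq_mul,
      BoundedContinuousFunction.coe_mul, Pi.mul_apply, sqResBCF, iNBCF, realBCF_apply]
    norm_cast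
    have h1 := sqrt_one_add_sq_pos (x / l)
    have h2 := sq_sqrt_one_add_sq (x / l)
    obtain ⟨u, rfl⟩ : ∃ u, x = l * u := ⟨x / l, by field_simp⟩
    rw [mul_div_cancel_left₀ _ hl.ne'] at *
    set s := √(1 + u ^ 2)
    have h3 : (l * u) ^ 2 + l ^ 2 = l ^ 2 * s ^ 2 := by rw [h2]; ring
    rw [h3]
    field_simp
    linear_combination -h2
  rw [h, hD.bddCalc_smul_apply, hD.bddCalc_sub_apply, hD.bddCalc_smul_apply,
    hD.bddCalc_mul_apply, map_one, hD.approximant_eq hl]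
  simp

lemma rescale (hD : IsEssSelfAdjointMultiplier D) {t : ℝ} (ht : 0 < t) :
    IsEssSelfAdjointMultiplier (rescale D t) := by
  have hk : ((t⁻¹ : ℝ) : ℂ) ≠ 0 := by exact_mod_cast (inv_pos.2 ht).ne'
  have hmem : ∀ {x y : C}, (x, y) ∈ (UnboundedMultiplier.rescale D t).closure.graph ↔
      (x, (t : ℂ) • y) ∈ D.closure.graph := by
    intro x y
    have := mem_closure_smul_graph_iff hD.closable hk (x := x) (y := y)
    rw [Complex.ofReal_inv, inv_inv] at this
    rw [← this, UnboundedMultiplier.rescale, Complex.ofReal_inv]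
  have hclosable : (UnboundedMultiplier.rescale D t).IsClosable := isClosable_smul hD.closable hk
  have hA := hD.closure_selfAdjoint
  refine ⟨hD.dense_domain, fun x y c h => ?_, hclosable, ?_, fun x y c h => ?_,
    fun x y => ?_, ?_⟩
  · rw [UnboundedMultiplier.rescale, mem_smul_graph_iff hk] at h ⊢
    rw [← smul_mul_assoc]
    exact hD.mul_mem_graph _ _ _ h
  · refine hD.dense_domain.mono ?_
    exact (LinearPMap.le_closure (UnboundedMultiplier.rescale D t)).1
  · rw [hmem] at h ⊢
    rw [← smul_mul_assoc]
    exact hA.mul_mem_graph _ _ _ h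
  · rw [hmem, hA.mem_graph_iff]
    constructor
    · intro h z w hzw
      have h1 := h z _ (hmem.1 hzw)
      rw [star_smul, smul_mul_assoc, mul_smul_comm, Complex.star_def, Complex.conj_ofReal] at h1
      exact smul_right_injective C (Complex.ofReal_ne_zero.2 ht.ne') h1
    · intro h z w hzw
      have h1 := h z ((t : ℂ)⁻¹ • w) (hmem.2 (by
        rwa [smul_inv_smul₀ (Complex.ofReal_ne_zero.2 ht.ne')]))
      rw [star_smul, smul_mul_assoc, star_inv₀, Complex.star_def, Complex.conj_ofReal] at h1
      rw [mul_smul_comm, ← h1, smul_inv_smul₀ (Complex.ofReal_ne_zero.2 ht.ne')]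
  · refine dense_univ.mono fun a _ => ?_
    obtain ⟨y, z, h1, h2, h3⟩ := hD.exists_sq_solution ht a
    set x := (hD.bddCalc (sqResBCF t ht)).fst a
    have ht' : (t : ℂ) ≠ 0 := Complex.ofReal_ne_zero.2 ht.ne'
    -- Regularity of `t⁻¹D`: a solution of `(D² + t²)x = a` gives `(1 + t⁻²D²)(t²x) = a`.
    refine ⟨((t ^ 2 : ℝ) : ℂ) • x, (t : ℂ) • y, z, hmem.2 ?_, hmem.2 ?_, ?_⟩
    · rw [smul_smul, ← sq, ← Complex.ofReal_pow]
      exact D.closure.graph.smul_mem _ h1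
    · exact D.closure.graph.smul_mem _ h2
    · rw [add_comm]
      exact h3.symm

end IsEssSelfAdjointMultiplier

lemma mem_closure_rescale_graph_iff {E : C →ₗ.[ℂ] C} (hE : E.IsClosable) {t : ℝ} (ht : 0 < t)
    {x y : C} :
    (x, ((t⁻¹ : ℝ) : ℂ) • y) ∈ (rescale E t).closure.graph ↔ (x, y) ∈ E.closure.graph := by
  have hk : ((t⁻¹ : ℝ) : ℂ) ≠ 0 := by exact_mod_cast (inv_pos.2 ht).ne'
  rw [rescale, mem_closure_smul_graph_iff hE hk, inv_smul_smul₀ hk]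

lemma rescale_add (D D' : C →ₗ.[ℂ] C) (t : ℝ) :
    rescale D t + rescale D' t = rescale (D + D') t := by
  refine LinearPMap.ext rfl fun x hx hx' => ?_
  simp only [rescale, LinearPMap.smul_apply, LinearPMap.add_apply, smul_add]

lemma IsInvariantCore.rescale {D : C →ₗ.[ℂ] C} {S : Submodule ℂ C} {δ : S →ₗ[ℂ] S}
    (h : IsInvariantCore D S δ) (hD : IsEssSelfAdjointMultiplier D) {t : ℝ} (ht : 0 < t) :
    IsInvariantCore (rescale D t) S (((t⁻¹ : ℝ) : ℂ) • δ) where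
  mem_graph c := (mem_closure_rescale_graph_iff hD.closable ht).2 (h.mem_graph c)
  exists_solution l hl c := by
    -- Because `(t⁻²D² + l²) t² = D² + (lt)²`.
    obtain ⟨d, hd⟩ := h.exists_solution (l * t) (mul_pos hl ht) c
    have ht' : (t : ℂ) ≠ 0 := Complex.ofReal_ne_zero.2 ht.ne'
    refine ⟨((t ^ 2 : ℝ) : ℂ) • d, ?_⟩
    rw [← hd]
    simp only [LinearMap.smul_apply, map_smul, smul_smul]
    congr 2
    · push_cast
      field_simp
      simp
    · push_cast
      ring

/-! ### Consequences of a bounded commutator -/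

/-- Surjectivity of the resolvent on `S` gives `DS ⊆ S`: if `c = (D + i)⁻¹c'`, then `Dc = c' - ic`.
Invariance under every `D_l` gives solvability of `D² + l²` inside `S`. -/
lemma exists_isInvariantCore {D : C →ₗ.[ℂ] C} (hD : IsEssSelfAdjointMultiplier D)
    {S : Submodule ℂ C} (hS : ∀ N : ℝ, 0 < N → ∀ c ∈ S, (approximant D N).fst c ∈ S)
    (hR : Set.BijOn (resolvent D Complex.I).fst S S) :
    ∃ δ : S →ₗ[ℂ] S, IsInvariantCore D S δ := by
  have hex : ∀ c : S, ∃ y : S, ((c : C), (y : C)) ∈ D.closure.graph := fun c => by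
    obtain ⟨c', hc', h⟩ := hR.surjOn c.2
    refine ⟨⟨c' - Complex.I • c, S.sub_mem hc' (S.smul_mem _ c.2)⟩, ?_⟩
    have := hD.resolvent_mem (s := Complex.I) (by simp) (by simp) c'
    rwa [h] at this
  choose y hy using hex
  let δ : S →ₗ[ℂ] S :=
    { toFun := y
      map_add' := fun a b => Subtype.ext (D.closure.mem_graph_snd_inj (hy (a + b))
        (D.closure.graph.add_mem (hy a) (hy b)) rfl)
      map_smul' := fun k a => Subtype.ext (D.closure.mem_graph_snd_inj (hy (k • a))
        (D.closure.graph.smul_mem k (hy a)) rfl) }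
  refine ⟨δ, hy, fun l hl c => ?_⟩
  obtain ⟨u, v, h1, h2, h3⟩ := hD.exists_sq_solution hl (c : C)
  have hmem : (hD.bddCalc (sqResBCF l hl)).fst c ∈ S := by
    rw [hD.sqResBCF_apply_eq hl]
    exact S.smul_mem _ (S.sub_mem c.2 (S.smul_mem _ (hS l hl _ (hS l hl _ c.2))))
  refine ⟨⟨_, hmem⟩, Subtype.ext ?_⟩
  have h4 : (δ ⟨_, hmem⟩ : C) = u := D.closure.mem_graph_snd_inj (hy _) h1 rfl
  have h5 : (δ (δ ⟨_, hmem⟩) : C) = v := D.closure.mem_graph_snd_inj (hy _) h2 h4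
  rw [Submodule.coe_add, h5]
  exact h3

lemma IsCore.mem_closure {E : C →ₗ.[ℂ] C} (hE : E.IsClosable) {S : Submodule ℂ C}
    (hS : IsCore E S) {p : C × C} (hp : p ∈ E.closure.graph) :
    p ∈ closure {q : C × C | q.1 ∈ S ∧ q ∈ E.graph} := by
  have hle : E.domRestrict S ≤ E := LinearPMap.domRestrict_le
  rw [← hS.closure_eq, ← (hE.leIsClosable hle).graph_closure_eq_closure_graph] at hp
  have hsub : ((E.domRestrict S).graph : Set (C × C)) ⊆ {q : C × C | q.1 ∈ S ∧ q ∈ E.graph} :=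
    fun q hq => ⟨(LinearPMap.mem_domain_of_mem_graph (x := q.1) (y := q.2) hq).1,
      LinearPMap.le_graph_of_le hle hq⟩
  exact closure_mono hsub hp

lemma add_mem_graph {D D' : C →ₗ.[ℂ] C} {c x y : C} (h : (c, x) ∈ D.graph)
    (h' : (c, y) ∈ D'.graph) : (c, x + y) ∈ (D + D').graph := by
  rw [LinearPMap.mem_graph_iff] at h h' ⊢
  obtain ⟨⟨a, ha⟩, rfl, rfl⟩ := h
  obtain ⟨⟨b, hb⟩, hab, rfl⟩ := h'
  obtain rfl : b = a := hab
  exact ⟨⟨b, ha, hb⟩, rfl, rfl⟩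

/-- For a bounded commutator, the resolvents of `D_{t,N} + D'_{t,N}` and `D_t + D'_t` are
`O(1/N)`-close for all large `t`. -/
lemma HasBoundedCommutator.eventually_norm_inv_sub_resolvent_le {D D' : C →ₗ.[ℂ] C}
    (hBC : HasBoundedCommutator D D') (hD : IsEssSelfAdjointMultiplier D)
    (hD' : IsEssSelfAdjointMultiplier D') :
    ∀ᶠ t : ℝ in atTop, 0 < t ∧ ∀ N : ℝ, 0 < N → ∀ V : 𝓜(ℂ, C),
      V * (approximant (rescale D t) N + approximant (rescale D' t) N +
        algebraMap ℂ _ Complex.I) = 1 →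
      ‖V - resolvent (rescale D t + rescale D' t) Complex.I‖ ≤ 6 / N := by
  obtain ⟨hT, S, hS, -, hST, hinv, hbij, B, hB⟩ := hBC
  obtain ⟨δ, hδ⟩ := exists_isInvariantCore hD (fun N hN c hc => (hinv N hN c hc).1)
    (hbij Complex.I (Or.inl rfl)).1
  obtain ⟨δ', hδ'⟩ := exists_isInvariantCore hD' (fun N hN c hc => (hinv N hN c hc).2)
    (hbij Complex.I (Or.inl rfl)).2
  have hle := LinearPMap.le_graph_of_le D.le_closure
  have hle' := LinearPMap.le_graph_of_le D'.le_closure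
  -- The intermediate vectors in the commutator hypothesis are the values of `δ` and `δ'`, because
  -- closures are single-valued.
  have hval : ∀ c : S, ((c : C), (δ c : C)) ∈ D.graph ∧ ((c : C), (δ' c : C)) ∈ D'.graph ∧
      B c = (δ (δ' c) : C) + δ' (δ c) := by
    intro c
    obtain ⟨x, x', y, y', h1, h2, h3, h4, h5⟩ := hB c c.2
    obtain rfl : x = δ c := D.closure.mem_graph_snd_inj (hle h1) (hδ.mem_graph c) rfl
    obtain rfl : x' = δ' c := D'.closure.mem_graph_snd_inj (hle' h3) (hδ'.mem_graph c) rfl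
    obtain rfl : y' = δ' (δ c) := D'.closure.mem_graph_snd_inj (hle' h2) (hδ'.mem_graph _) rfl
    obtain rfl : y = δ (δ' c) := D.closure.mem_graph_snd_inj (hle h4) (hδ.mem_graph _) rfl
    exact ⟨h1, h3, h5⟩
  -- The commutator scales by `t⁻²`; this fixes the threshold for `t` before `N` appears.
  have hev : ∀ᶠ t : ℝ in atTop, 144 * ((t⁻¹ * t⁻¹) * ‖B‖) ≤ 1 := by
    have h1 : Tendsto (fun t : ℝ => 144 * ((t⁻¹ * t⁻¹) * ‖B‖)) atTop (𝓝 (144 * ((0 * 0) * ‖B‖))) :=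
      ((tendsto_inv_atTop_zero.mul tendsto_inv_atTop_zero).mul_const _).const_mul _
    rw [zero_mul, zero_mul, mul_zero] at h1
    exact h1.eventually_le_const one_pos
  filter_upwards [eventually_gt_atTop 0, hev] with t ht htB
  refine ⟨ht, fun N hN V hV => ?_⟩
  set k : ℂ := ((t⁻¹ : ℝ) : ℂ) with hk
  have hgraph : ∀ c : S, ((c : C), ((k • δ) c : C) + (k • δ') c) ∈
      (rescale (D + D') t).closure.graph := fun c => by
    have h1 := (mem_closure_rescale_graph_iff hT.closable ht).2
      (LinearPMap.le_graph_of_le (D + D').le_closure (add_mem_graph (hval c).1 (hval c).2.1))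
    rw [smul_add] at h1
    exact h1
  refine norm_inv_sub_resolvent_le (hδ.rescale hD ht) (hδ'.rescale hD' ht) (hD.rescale ht)
    (hD'.rescale ht) (by rw [rescale_add]; exact hT.rescale ht) hS.dense (by rwa [rescale_add]) (fun p hp => ?_)
    (B := (k * k) • B) (fun c => ?_) ?_ hN hV
  · rw [rescale_add] at hp
    obtain ⟨x, y⟩ := p
    have hk0 : k ≠ 0 := by
      rw [hk]; exact_mod_cast (inv_pos.2 ht).ne'
    have h1 : (x, k⁻¹ • y) ∈ (D + D').closure.graph :=
      (mem_closure_smul_graph_iff hT.closable hk0).1 hp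
    have h2 := hST.mem_closure hT.closable h1
    have h3 : Continuous fun q : C × C => (q.1, k • q.2) := by fun_prop
    -- Approximation of the graph of `D + D'` from the core is transported by the continuous
    -- rescaling of the second coordinate.
    have h4 := map_mem_closure h3 h2 (t := Set.range fun c : S =>
      ((c : C), ((k • δ) c : C) + (k • δ') c)) (by
        rintro ⟨a, b⟩ ⟨ha, hab⟩
        refine ⟨⟨a, ha⟩, Prod.ext rfl ?_⟩
        have h5 := add_mem_graph (hval ⟨a, ha⟩).1 (hval ⟨a, ha⟩).2.1
        have h6 : b = _ := (D + D').mem_graph_snd_inj hab h5 rfl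
        change k • _ + k • _ = k • b
        rw [h6, smul_add])
    rwa [smul_inv_smul₀ hk0] at h4
  · simp only [LinearMap.smul_apply, map_smul, smul_apply, (hval c).2.2, smul_smul, smul_add,
      Submodule.coe_smul]
    rfl
  · rw [norm_smul, norm_mul, hk, Complex.norm_real, Real.norm_of_nonneg (by positivity)]
    exact htB

/-! ### Uniform continuity of the functional calculus -/

/-- By Stone–Weierstrass: the property holds for constants, `z` and `z̄`, and passes to sums,
products and uniform limits. The modulus `η` depends on `f` and `ε` but not on the elements. -/
lemma cfcHomSuperset_uniform {A : Type*} [CStarAlgebra A] {K : Set ℂ} [CompactSpace K]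
    (f : C(K, ℂ)) : ∀ ε > 0, ∃ η > 0, ∀ (u v : A) (hu : IsStarNormal u) (hv : IsStarNormal v)
      (hu' : spectrum ℂ u ⊆ K) (hv' : spectrum ℂ v ⊆ K), ‖u - v‖ ≤ η →
      ‖cfcHomSuperset hu hu' f - cfcHomSuperset hv hv' f‖ ≤ ε := by
  have hbd : ∀ (u : A) (hu : IsStarNormal u) (hu' : spectrum ℂ u ⊆ K) (f : C(K, ℂ)),
      ‖cfcHomSuperset hu hu' f‖ ≤ ‖f‖ := fun u hu hu' f =>
    NonUnitalStarAlgHom.norm_apply_le _ f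
  induction f using ContinuousMap.induction_on_of_compact with
  | const r =>
    refine fun ε hε => ⟨1, one_pos, fun u v hu hv hu' hv' _ => ?_⟩
    have : ContinuousMap.const K r = algebraMap ℂ C(K, ℂ) r := rfl
    rw [this, AlgHomClass.commutes, AlgHomClass.commutes, sub_self, norm_zero]
    exact hε.le
  | id =>
    refine fun ε hε => ⟨ε, hε, fun u v hu hv hu' hv' h => ?_⟩
    rwa [cfcHomSuperset_id, cfcHomSuperset_id]
  | star_id =>
    refine fun ε hε => ⟨ε, hε, fun u v hu hv hu' hv' h => ?_⟩
    rwa [map_star, map_star, cfcHomSuperset_id, cfcHomSuperset_id, ← star_sub, norm_star]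
  | add f g hf hg =>
    intro ε hε
    obtain ⟨η₁, h₁, hf⟩ := hf (ε / 2) (by positivity)
    obtain ⟨η₂, h₂, hg⟩ := hg (ε / 2) (by positivity)
    refine ⟨min η₁ η₂, lt_min h₁ h₂, fun u v hu hv hu' hv' h => ?_⟩
    have h3 := hf u v hu hv hu' hv' (h.trans (min_le_left _ _))
    have h4 := hg u v hu hv hu' hv' (h.trans (min_le_right _ _))
    rw [map_add, map_add, add_sub_add_comm]
    exact (norm_add_le _ _).trans (by linarith)
  | mul f g hf hg =>
    intro ε hε
    obtain ⟨η₁, h₁, hf⟩ := hf (ε / (2 * (‖g‖ + 1))) (by positivity)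
    obtain ⟨η₂, h₂, hg⟩ := hg (ε / (2 * (‖f‖ + 1))) (by positivity)
    refine ⟨min η₁ η₂, lt_min h₁ h₂, fun u v hu hv hu' hv' h => ?_⟩
    have h3 := hf u v hu hv hu' hv' (h.trans (min_le_left _ _))
    have h4 := hg u v hu hv hu' hv' (h.trans (min_le_right _ _))
    have h5 := hbd u hu hu' f
    have h6 := hbd v hv hv' g
    have h7 : ∀ a b c d : A, a * b - c * d = (a - c) * d + a * (b - d) := fun a b c d => by
      noncomm_ring
    rw [map_mul, map_mul, h7]
    refine (norm_add_le _ _).trans ?_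
    have h8 : ‖(cfcHomSuperset hu hu' f - cfcHomSuperset hv hv' f) * cfcHomSuperset hv hv' g‖ ≤
        ε / (2 * (‖g‖ + 1)) * (‖g‖ + 1) :=
      (norm_mul_le _ _).trans (by gcongr; linarith)
    have h9 : ‖cfcHomSuperset hu hu' f * (cfcHomSuperset hu hu' g - cfcHomSuperset hv hv' g)‖ ≤
        (‖f‖ + 1) * (ε / (2 * (‖f‖ + 1))) :=
      (norm_mul_le _ _).trans (by gcongr; linarith)
    have h10 : ε / (2 * (‖g‖ + 1)) * (‖g‖ + 1) = ε / 2 := by field_simp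
    have h11 : (‖f‖ + 1) * (ε / (2 * (‖f‖ + 1))) = ε / 2 := by field_simp
    linarith
  | frequently f hf =>
    intro ε hε
    obtain ⟨g, hg, hgf⟩ := (hf.and_eventually (Metric.ball_mem_nhds f
      (by positivity : 0 < ε / 3))).exists
    obtain ⟨η, hη, h⟩ := hg (ε / 3) (by positivity)
    refine ⟨η, hη, fun u v hu hv hu' hv' huv => ?_⟩
    have h1 := h u v hu hv hu' hv' huv
    have h2 := hbd u hu hu' (f - g)
    have h3 := hbd v hv hv' (g - f)
    rw [dist_eq_norm] at hgf
    rw [norm_sub_rev f g] at h2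
    rw [map_sub] at h2 h3
    have h4 : cfcHomSuperset hu hu' f - cfcHomSuperset hv hv' f =
        (cfcHomSuperset hu hu' f - cfcHomSuperset hu hu' g) +
        (cfcHomSuperset hu hu' g - cfcHomSuperset hv hv' g) +
        (cfcHomSuperset hv hv' g - cfcHomSuperset hv hv' f) := by abel
    rw [h4]
    refine (norm_add₃_le).trans ?_
    linarith

/-- The functional calculus of a fixed function is uniformly continuous on the normal elements
with spectrum in a fixed compact set. -/
lemma cfc_uniform {A : Type*} [CStarAlgebra A] {K : Set ℂ} (hK : IsCompact K) {f : ℂ → ℂ}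
    (hf : ContinuousOn f K) {ε : ℝ} (hε : 0 < ε) : ∃ η > 0, ∀ u v : A, IsStarNormal u →
      IsStarNormal v → spectrum ℂ u ⊆ K → spectrum ℂ v ⊆ K → ‖u - v‖ ≤ η →
      ‖cfc f u - cfc f v‖ ≤ ε := by
  have := isCompact_iff_compactSpace.1 hK
  obtain ⟨η, hη, h⟩ := cfcHomSuperset_uniform (A := A) ⟨K.domRestrict f, hf.domRestrict⟩ ε hε
  refine ⟨η, hη, fun u v hu hv hu' hv' huv => ?_⟩
  have h1 := h u v hu hv hu' hv' huv
  rwa [cfc_apply f u hu (hf.mono hu'), cfc_apply f v hv (hf.mono hv')]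

/-! ### The circle of resolvent values -/

/-- The circle `{(x + i)⁻¹ : x ∈ ℝ} ∪ {0}`. -/
def resolventCircle : Set ℂ := {w | Complex.normSq w = -w.im}

lemma isCompact_resolventCircle : IsCompact resolventCircle := by
  refine Metric.isCompact_of_isClosed_isBounded ?_ ?_
  · exact isClosed_eq Complex.continuous_normSq (by fun_prop)
  · refine (Metric.isBounded_closedBall (x := (0 : ℂ)) (r := 1)).subset fun w hw => ?_
    rw [mem_closedBall_zero_iff]
    have h1 : ‖w‖ ^ 2 = -w.im := by rw [← Complex.normSq_eq_norm_sq]; exact hw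
    have h2 := Complex.abs_im_le_norm w
    have h3 := neg_le_abs w.im
    nlinarith [norm_nonneg w]

lemma inv_eq_of_mem_resolventCircle {w : ℂ} (hw : w ∈ resolventCircle) (hw0 : w ≠ 0) :
    w⁻¹ = ((w⁻¹ - Complex.I).re : ℂ) + Complex.I := by
  have h0 : Complex.normSq w ≠ 0 := by simpa using hw0
  have hw' : Complex.normSq w = -w.im := hw
  apply Complex.ext
  · simp
  · simp only [Complex.inv_im, Complex.add_im, Complex.ofReal_im, Complex.I_im, zero_add]
    rw [← hw', div_self h0]

lemma inv_add_I_mem_resolventCircle (x : ℝ) : ((x : ℂ) + Complex.I)⁻¹ ∈ resolventCircle := by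
  have h : Complex.normSq ((x : ℂ) + Complex.I) = x * x + 1 := by simp [Complex.normSq_apply]
  change Complex.normSq _ = -Complex.im _
  rw [Complex.normSq_inv, Complex.inv_im, h]
  simp [neg_div]

/-- The function on the resolvent circle corresponding to `f` on the real line. -/
noncomputable def circleFun (f : ℝ → ℂ) (w : ℂ) : ℂ :=
  if w = 0 then 0 else f (w⁻¹ - Complex.I).re

lemma circleFun_inv (f : ℝ → ℂ) (x : ℝ) : circleFun f (((x : ℂ) + Complex.I)⁻¹) = f x := by
  rw [circleFun, if_neg (inv_ne_zero (IsEssSelfAdjointMultiplier.add_I_ne_zero x)), inv_inv]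
  simp

/-- The point `0` of the circle represents infinity on the line, so continuity there is the
vanishing of `f` at infinity. -/
lemma continuousOn_circleFun {f : ℝ → ℂ} (hf : Continuous f)
    (hf0 : Tendsto f (cocompact ℝ) (𝓝 0)) : ContinuousOn (circleFun f) resolventCircle := by
  intro w hw
  by_cases hw0 : w = 0
  · subst hw0
    rw [← continuousWithinAt_sdiff_self]
    have h1 : Tendsto (fun w : ℂ => ‖w⁻¹ - Complex.I‖) (𝓝[resolventCircle \ {0}] 0) atTop := by
      refine Tendsto.comp (g := fun z : ℂ => ‖z - Complex.I‖) (y := Bornology.cobounded ℂ) ?_ ?_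
      · refine tendsto_atTop_mono (f := fun z : ℂ => ‖z‖ - 1) (fun z => ?_) ?_
        · have := norm_sub_norm_le z Complex.I
          simpa using this
        · exact tendsto_atTop_add_const_right _ _ tendsto_norm_cobounded_atTop
      · exact (tendsto_inv₀_nhdsNE_zero).mono_left (nhdsWithin_mono _ fun z hz => hz.2)
    have h2 : Tendsto (fun w : ℂ => (w⁻¹ - Complex.I).re)
        (𝓝[resolventCircle \ {0}] 0) (cocompact ℝ) := by
      rw [← Metric.cobounded_eq_cocompact, ← tendsto_norm_atTop_iff_cobounded]
      refine h1.congr' ?_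
      filter_upwards [self_mem_nhdsWithin] with z hz
      conv_lhs => rw [inv_eq_of_mem_resolventCircle hz.1 hz.2, add_sub_cancel_right,
        Complex.norm_real]
    rw [ContinuousWithinAt, circleFun, if_pos rfl]
    refine (hf0.comp h2).congr' ?_
    filter_upwards [self_mem_nhdsWithin] with z hz
    simp [circleFun, show z ≠ 0 from hz.2]
  · apply ContinuousAt.continuousWithinAt
    have h1 : ContinuousAt (fun w : ℂ => f (w⁻¹ - Complex.I).re) w := by
      refine hf.continuousAt.comp (Complex.continuous_re.continuousAt.comp ?_)
      exact (continuousAt_inv₀ hw0).sub continuousAt_const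
    refine h1.congr ?_
    filter_upwards [isOpen_ne.mem_nhds hw0] with z hz
    simp [circleFun, show z ≠ 0 from hz]

lemma IsEssSelfAdjointMultiplier.spectrum_resolvent_subset {D : C →ₗ.[ℂ] C}
    (hD : IsEssSelfAdjointMultiplier D) :
    spectrum ℂ (resolvent D Complex.I) ⊆ resolventCircle := by
  intro w hw
  by_cases hw0 : w = 0
  · simp [hw0, resolventCircle]
  · have h := hD.mem_spectrum hw hw0
    have h1 := inv_add_I_mem_resolventCircle (w⁻¹ - Complex.I).re
    rwa [← h, inv_inv] at h1

/-- The resolvent of a self-adjoint multiplier `X`, and `f(X)` as a function of it. -/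
lemma exists_inv_of_isSelfAdjoint {X : 𝓜(ℂ, C)} (hX : IsSelfAdjoint X) {f : ℝ → ℂ}
    (hf : Continuous f) (hf0 : Tendsto f (cocompact ℝ) (𝓝 0)) :
    ∃ V : 𝓜(ℂ, C), V * (X + algebraMap ℂ _ Complex.I) = 1 ∧ IsStarNormal V ∧
      spectrum ℂ V ⊆ resolventCircle ∧ multiplierCalc X f = cfc (circleFun f) V := by
  have hXn : IsStarNormal X := hX.isStarNormal
  have hre : ∀ z ∈ spectrum ℂ X, z = (z.re : ℂ) := fun z hz => hX.mem_spectrum_eq_re hz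
  have hne : ∀ z ∈ spectrum ℂ X, z + Complex.I ≠ 0 := fun z hz => by
    rw [hre z hz]
    exact IsEssSelfAdjointMultiplier.add_I_ne_zero _
  have hc : ContinuousOn (fun z : ℂ => (z + Complex.I)⁻¹) (spectrum ℂ X) :=
    ContinuousOn.inv₀ (by fun_prop) hne
  have hsub : (fun z : ℂ => (z + Complex.I)⁻¹) '' spectrum ℂ X ⊆ resolventCircle := by
    rintro _ ⟨z, hz, rfl⟩
    have := inv_add_I_mem_resolventCircle z.re
    rwa [← hre z hz] at this
  refine ⟨cfc (fun z : ℂ => (z + Complex.I)⁻¹) X, ?_, cfc_predicate _ _, ?_, ?_⟩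
  · have h1 : X + algebraMap ℂ _ Complex.I = cfc (fun z : ℂ => z + Complex.I) X := by
      rw [cfc_add_const Complex.I (fun z : ℂ => z) X, cfc_id' ℂ X]
    rw [h1, ← cfc_mul (fun z : ℂ => (z + Complex.I)⁻¹) (fun z => z + Complex.I) X hc, ← cfc_one ℂ X]
    exact cfc_congr fun z hz => inv_mul_cancel₀ (hne z hz)
  · rw [cfc_map_spectrum (fun z : ℂ => (z + Complex.I)⁻¹) X hXn hc]
    exact hsub
  · rw [multiplierCalc, ← cfc_comp' (circleFun f) (fun z : ℂ => (z + Complex.I)⁻¹) X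
      ((continuousOn_circleFun hf hf0).mono hsub) hc]
    refine cfc_congr fun z hz => ?_
    have := circleFun_inv f z.re
    rw [← hre z hz] at this
    exact this.symm

end UnboundedMultiplier

/-! ### The limit theorem -/

open UnboundedMultiplier in
theorem mainTheorem5 {C : Type*} [NonUnitalCStarAlgebra C]
    (γ : C ≃⋆ₐ[ℂ] C) (hγ : ∀ x, γ (γ x) = x)
    (D D' : C →ₗ.[ℂ] C)
    (hD : UnboundedMultiplier.IsEssSelfAdjointMultiplier D)
    (hD' : UnboundedMultiplier.IsEssSelfAdjointMultiplier D')
    (hodd : UnboundedMultiplier.IsOdd γ D) (hodd' : UnboundedMultiplier.IsOdd γ D')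
    (hBC : UnboundedMultiplier.HasBoundedCommutator D D')
    (f : C₀(ℝ, ℂ)) :
    Tendsto (fun N : ℝ => limsup (fun t : ℝ =>
        ‖UnboundedMultiplier.multiplierCalc
            (UnboundedMultiplier.approximant (UnboundedMultiplier.rescale D t) N +
              UnboundedMultiplier.approximant (UnboundedMultiplier.rescale D' t) N) f -
          UnboundedMultiplier.funCalc
            (UnboundedMultiplier.rescale D t + UnboundedMultiplier.rescale D' t) f‖ₑ)
        atTop) atTop (𝓝 0) := by
  rw [ENNReal.tendsto_nhds_zero]
  intro ε hε
  -- The limit is taken in extended nonnegative reals, where `ε` may be infinite; a positive real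
  -- below it is used instead.
  obtain ⟨ε', hε', hεε⟩ : ∃ ε' : ℝ, 0 < ε' ∧ ENNReal.ofReal ε' ≤ ε := by
    rcases eq_or_ne ε ⊤ with rfl | h
    · exact ⟨1, one_pos, le_top⟩
    · exact ⟨ε.toReal, ENNReal.toReal_pos hε.ne' h, ENNReal.ofReal_toReal_le⟩
  have hf : Continuous (f : ℝ → ℂ) := f.continuous
  have hf0 : Tendsto (f : ℝ → ℂ) (cocompact ℝ) (𝓝 0) := f.zero_at_infty'
  -- The tolerance `η` depends only on `f` and `ε'`, so `6/N ≤ η` selects `N` independently of `t`.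
  obtain ⟨η, hη, huniform⟩ := cfc_uniform (A := 𝓜(ℂ, C)) isCompact_resolventCircle
    (continuousOn_circleFun hf hf0) hε'
  have hN : ∀ᶠ N : ℝ in atTop, 6 / N ≤ η :=
    (tendsto_const_nhds.div_atTop tendsto_id).eventually_le_const hη
  filter_upwards [hN, eventually_gt_atTop 0] with N hNη hN0
  refine limsup_le_of_le (by isBoundedDefault) ?_
  filter_upwards [hBC.eventually_norm_inv_sub_resolvent_le hD hD'] with t ht
  have hT : IsEssSelfAdjointMultiplier (rescale D t + rescale D' t) := by
    rw [rescale_add]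
    exact hBC.1.rescale ht.1
  obtain ⟨V, hV, hVn, hVs, hVf⟩ := exists_inv_of_isSelfAdjoint
    ((isSelfAdjoint_approximant (hD.rescale ht.1) hN0).add
      (isSelfAdjoint_approximant (hD'.rescale ht.1) hN0)) hf hf0
  have h1 := ht.2 N hN0 V hV
  have h2 := huniform V _ hVn hT.isStarNormal_resolvent hVs hT.spectrum_resolvent_subset
    (h1.trans hNη)
  rw [hVf, ← ofReal_norm]
  exact (ENNReal.ofReal_le_ofReal h2).trans hεε
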